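/- Let $M$ be a smooth connected manifold of dimension $n$ (Hausdorff, second countable, without boundary), and let $\mu$ be a $\sigma$-finite Borel measure on $M$ with full support which is smooth and positive, i.e. in charts $\mu=r\,dx$ with $r\in C^\infty$, $r>0$. Let $(P_t)_{t\ge0}$ be a symmetric Markov $C_0$-semigroup on $L^2(M,\mu)$ which is conservative ($P_t1=1$, where $P_t$ is extended to bounded functions by monotone limits). Let $L$ be its generator, and let $\mathcal E(f,g)=\lim_{t\downarrow0}t^{-1}\langle f-P_tf,g\rangle_{L^2(\mu)}$ be its Dirichlet form, with domain $\mathcal D(\mathcal E)=\{f\in L^2(\mu):\mathcal E(f,f)<\infty\}$. Assume that * $\mathcal E$ is strongly local: $\mathcal E(f,g)=0$ for $f,g\in\mathcal D(\mathcal E)$ whenever $f$ is constant on a neighbourhood of $\operatorname{supp}g$; * $\mathcal E$ is regular: $\mathcal D(\mathcal E)\cap C_c(M)$ is dense in $\mathcal D(\mathcal E)$ for the norm $(\mathcal E(f,f)+\|f\|_{L^2(\mu)}^2)^{1/2}$ and in $C_c(M)$ for the uniform norm; * $C_c^\infty(M)\subset\mathrm{Dom}(L)$; * $P_t$ has a smooth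 carré du champ, i.e. there is a symmetric bilinear map $\Gamma:C^\infty(M)\times C^\infty(M)\to C^\infty(M)$ such that $$\Gamma(f,g)=\lim_{t\downarrow0}\frac1{2t}\bigl(P_t(fg)-(P_tf)(P_tg)\bigr)\qquad(f,g\in C_c^\infty(M))$$ pointwise (for $L^2$-classes: along every sequence $t_k\downarrow0$ the convergence holds $\mu$-almost everywhere); $\Gamma(f,g)(x)$ depends only on $df(x),dg(x)$; $\Gamma(f,g)=0$ if $g$ is constant near $\operatorname{supp}f$; and $\Gamma$ satisfies in each argument the Leibniz rule $\Gamma(fg,h)=f\,\Gamma(g,h)+g\,\Gamma(f,h)$ and the chain rule $\Gamma(\phi\circ f,g)=\phi'(f)\,\Gamma(f,g)$ for all $\phi\in C^\infty(\mathbb R)$; * $\Gamma$ is non-degenerate: $\Gamma(f,f)(x)>0$ whenever $f\in C^\infty(M)$ and $df(x)\neq0$. Then there is a unique smooth Riemannian metric $g$ on $M$ with $\Gamma(f,h)=\langle df,dh\rangle_{g^{-1}}=\langle\nabla f,\nabla h\rangle_g$ for all $f,h\in C^\infty(M)$, and for this $g$: 1. There is a unique smooth function $\rho:M\to(0,\infty)$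 with $d\mu=\rho\,d\mathrm{vol}_g$. 2. $Lf=\Delta_gf+\langle\nabla\log\rho,\nabla f\rangle_g$ $\mu$-a.e. for every smooth $f\in\mathrm{Dom}(L)$, where $\Delta_g$ is the Laplace–Beltrami operator. 3. If $\sigma:M\to(0,\infty)$ is smooth and $Lf=\Delta_gf+\langle\nabla\log\sigma,\nabla f\rangle_g$ $\mu$-a.e. for all $f\in C_c^\infty(M)$, then $\sigma=c\rho$ for a constant $c>0$. 4. The semigroup determines $\mu$ up to normalization: if $\nu$ is a smooth positive measure on $M$ with $\int_M(P_tf)\,h\,d\nu=\int_Mf\,(P_th)\,d\nu$ for all $t\ge0$ and $f,h\in C_c^\infty(M)$, then $\nu=c\mu$ for a constant $c>0$. -/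

import Mathlib

open Set Filter Topology MeasureTheory
open scoped Manifold ContDiff NNReal

noncomputable section

/-- Smooth real functions on an `n`-dimensional manifold. -/
abbrev SmoothFn (n : ℕ) (M : Type*) [TopologicalSpace M]
    [ChartedSpace (EuclideanSpace ℝ (Fin n)) M] : Type _ :=
  ContMDiffMap (𝓡 n) 𝓘(ℝ, ℝ) M ℝ ∞

/-- Smooth Riemannian metrics on `M`. -/
abbrev SmoothMetric (n : ℕ) (M : Type*) [TopologicalSpace M]
    [ChartedSpace (EuclideanSpace ℝ (Fin n)) M] [IsManifold (𝓡 n) ∞ M] : Type _ :=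
  Bundle.ContMDiffRiemannianMetric (𝓡 n) ∞ (EuclideanSpace ℝ (Fin n))
    (fun x : M => TangentSpace (𝓡 n) x)

section Semigroup

variable {M : Type*} [MeasurableSpace M] {μ : Measure M}

/-- `u ∈ Dom(L)` and `L u = v`, where `L` is the `L²`-generator of `P`:
`(P_t u - u) / t → v` in `L²` as `t ↓ 0`. -/
def HasGenerator (P : ℝ≥0 → Lp ℝ 2 μ →L[ℝ] Lp ℝ 2 μ) (u v : Lp ℝ 2 μ) : Prop :=
  Tendsto (fun t : ℝ≥0 => (t : ℝ)⁻¹ • (P t u - u)) (𝓝[>] 0) (𝓝 v)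

/-- The form `𝓔(u, v) = lim_{t ↓ 0} t⁻¹ ⟨u - P_t u, v⟩` exists, is finite and equals `c`. -/
def HasEnergy (P : ℝ≥0 → Lp ℝ 2 μ →L[ℝ] Lp ℝ 2 μ) (u v : Lp ℝ 2 μ) (c : ℝ) : Prop :=
  Tendsto (fun t : ℝ≥0 => (t : ℝ)⁻¹ * ∫ x, (u - P t u) x * v x ∂μ) (𝓝[>] 0) (𝓝 c)

/-- The domain of the form: `𝓔(u, u) < ∞`. -/
def formDomain (P : ℝ≥0 → Lp ℝ 2 μ →L[ℝ] Lp ℝ 2 μ) : Set (Lp ℝ 2 μ) :=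
  {u | ∃ c : ℝ, HasEnergy P u u c}

/-- `w` is the class of a continuous compactly supported function and lies in the form domain. -/
def IsCoreFn [TopologicalSpace M] (P : ℝ≥0 → Lp ℝ 2 μ →L[ℝ] Lp ℝ 2 μ) (φ : M → ℝ)
    (w : Lp ℝ 2 μ) : Prop :=
  Continuous φ ∧ HasCompactSupport φ ∧ w =ᵐ[μ] φ ∧ w ∈ formDomain P

/-- Conservative symmetric Markov `C₀`-semigroups on `L²(μ)` whose Dirichlet form is strongly
local and regular. -/
structure IsDiffusionSemigroup [TopologicalSpace M] (μ : Measure M)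
    (P : ℝ≥0 → Lp ℝ 2 μ →L[ℝ] Lp ℝ 2 μ) : Prop where
  zero : P 0 = ContinuousLinearMap.id ℝ (Lp ℝ 2 μ)
  add : ∀ s t : ℝ≥0, P (s + t) = (P s).comp (P t)
  strongly_continuous : ∀ u : Lp ℝ 2 μ, Tendsto (fun t : ℝ≥0 => P t u) (𝓝[>] 0) (𝓝 u)
  markov : ∀ (t : ℝ≥0) (u : Lp ℝ 2 μ), (∀ᵐ x ∂μ, 0 ≤ u x ∧ u x ≤ 1) →
    ∀ᵐ x ∂μ, 0 ≤ P t u x ∧ P t u x ≤ 1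
  /-- `P_t 1 = 1`. If `μ` is infinite then `1 ∉ L²(μ)`, and `P_t 1` is the monotone limit of
  `P_t u_k` for `0 ≤ u_k ↑ 1`, `u_k ∈ L²(μ)`. -/
  conservative : ∀ (t : ℝ≥0) (u : ℕ → Lp ℝ 2 μ),
    (∀ᵐ x ∂μ, (∀ k, 0 ≤ u k x) ∧ Monotone (fun k => u k x) ∧
      Tendsto (fun k => u k x) atTop (𝓝 1)) →
    ∀ᵐ x ∂μ, Tendsto (fun k => P t (u k) x) atTop (𝓝 1)
  symmetric : ∀ (t : ℝ≥0) (u v : Lp ℝ 2 μ), ∫ x, P t u x * v x ∂μ = ∫ x, u x * P t v x ∂μ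
  /-- `𝓔(u, v) = 0` if `v` vanishes outside a closed set `F` and `u` is constant on a
  neighbourhood `U` of `F`. -/
  strongly_local : ∀ u ∈ formDomain P, ∀ v ∈ formDomain P, ∀ F U : Set M,
    IsClosed F → IsOpen U → F ⊆ U → (∀ᵐ x ∂μ, x ∉ F → v x = 0) →
    (∃ c : ℝ, ∀ᵐ x ∂μ, x ∈ U → u x = c) → HasEnergy P u v 0
  /-- `𝓓(𝓔) ∩ C_c` is dense in `𝓓(𝓔)` for the norm `𝓔(u, u) + ‖u‖²`. -/
  regular_form : ∀ u ∈ formDomain P, ∀ ε > (0 : ℝ), ∃ (φ : M → ℝ) (w : Lp ℝ 2 μ) (c : ℝ),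
    IsCoreFn P φ w ∧ HasEnergy P (u - w) (u - w) c ∧ c + ‖u - w‖ ^ 2 < ε
  /-- `𝓓(𝓔) ∩ C_c` is uniformly dense in `C_c`. -/
  regular_unif : ∀ f : M → ℝ, Continuous f → HasCompactSupport f → ∀ ε > (0 : ℝ),
    ∃ (φ : M → ℝ) (w : Lp ℝ 2 μ), IsCoreFn P φ w ∧ ∀ x, |f x - φ x| < ε

end Semigroup

section Manifold

variable {n : ℕ} {M : Type*} [TopologicalSpace M] [ChartedSpace (EuclideanSpace ℝ (Fin n)) M]

/-- `μ` is a smooth positive measure: in charts it is `r dx` with `r` smooth and positive. -/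
def IsSmoothPositiveMeasure (n : ℕ) {M : Type*} [TopologicalSpace M]
    [ChartedSpace (EuclideanSpace ℝ (Fin n)) M] [MeasurableSpace M] (μ : Measure M) : Prop :=
  ∀ x : M, ∃ r : EuclideanSpace ℝ (Fin n) → ℝ,
    ContDiffOn ℝ ∞ r (chartAt (EuclideanSpace ℝ (Fin n)) x).target ∧
    (∀ y ∈ (chartAt (EuclideanSpace ℝ (Fin n)) x).target, 0 < r y) ∧
    ∀ A : Set M, MeasurableSet A → A ⊆ (chartAt (EuclideanSpace ℝ (Fin n)) x).source →
      μ A = ∫⁻ y in chartAt (EuclideanSpace ℝ (Fin n)) x '' A, ENNReal.ofReal (r y)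

/-- Compactly supported smooth functions belong to `Dom(L)`. -/
def HasSmoothCore (n : ℕ) {M : Type*} [TopologicalSpace M]
    [ChartedSpace (EuclideanSpace ℝ (Fin n)) M] [MeasurableSpace M] {μ : Measure M}
    (P : ℝ≥0 → Lp ℝ 2 μ →L[ℝ] Lp ℝ 2 μ) : Prop :=
  ∀ f : SmoothFn n M, HasCompactSupport f →
    ∃ u v : Lp ℝ 2 μ, u =ᵐ[μ] f ∧ HasGenerator P u v

/-- `Γ` is the carré du champ of `P`, and it is a smooth first-order diffusion calculus.
Bilinearity and smoothness of `Γ(f, g)` are part of the type of `Γ`. -/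
structure IsSmoothCarreDuChamp [MeasurableSpace M] {μ : Measure M}
    (P : ℝ≥0 → Lp ℝ 2 μ →L[ℝ] Lp ℝ 2 μ)
    (Γ : SmoothFn n M →ₗ[ℝ] SmoothFn n M →ₗ[ℝ] SmoothFn n M) : Prop where
  /-- `Γ(f, g) = lim_{t ↓ 0} (P_t (f g) - P_t f P_t g) / (2 t)` for compactly supported `f, g`.
  As `P_t f` is an `L²`-class, pointwise convergence means: along every sequence `t_k ↓ 0`,
  almost everywhere. -/
  limit : ∀ f g : SmoothFn n M, HasCompactSupport f → HasCompactSupport g →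
    ∀ u v w : Lp ℝ 2 μ, u =ᵐ[μ] f → v =ᵐ[μ] g → w =ᵐ[μ] (f * g : SmoothFn n M) →
    ∀ t : ℕ → ℝ≥0, (∀ k, 0 < t k) → Tendsto t atTop (𝓝 0) →
    ∀ᵐ x ∂μ, Tendsto (fun k => (2 * (t k : ℝ))⁻¹ * (P (t k) w x - P (t k) u x * P (t k) v x))
      atTop (𝓝 (Γ f g x))
  symm : ∀ f g, Γ f g = Γ g f
  /-- `Γ(f, g)(x)` depends only on `df(x)` and `dg(x)`. -/
  first_order : ∀ (f f' g g' : SmoothFn n M) (x : M),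
    (∀ v : TangentSpace (𝓡 n) x,
      mfderiv (𝓡 n) 𝓘(ℝ, ℝ) f x v = mfderiv (𝓡 n) 𝓘(ℝ, ℝ) f' x v) →
    (∀ v : TangentSpace (𝓡 n) x,
      mfderiv (𝓡 n) 𝓘(ℝ, ℝ) g x v = mfderiv (𝓡 n) 𝓘(ℝ, ℝ) g' x v) →
    Γ f g x = Γ f' g' x
  loc : ∀ (f g : SmoothFn n M) (U : Set M), IsOpen U → tsupport f ⊆ U →
    (∃ c : ℝ, ∀ x ∈ U, g x = c) → Γ f g = 0
  leibniz_left : ∀ f g h, Γ (f * g) h = f * Γ g h + g * Γ f h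
  leibniz_right : ∀ f g h, Γ h (f * g) = f * Γ h g + g * Γ h f
  chain_left : ∀ (φ : ℝ → ℝ) (f k g : SmoothFn n M), ContDiff ℝ ∞ φ → (∀ x, k x = φ (f x)) →
    ∀ x, Γ k g x = deriv φ (f x) * Γ f g x
  chain_right : ∀ (φ : ℝ → ℝ) (f k g : SmoothFn n M), ContDiff ℝ ∞ φ → (∀ x, k x = φ (g x)) →
    ∀ x, Γ f k x = deriv φ (g x) * Γ f g x

/-- Non-degeneracy: the bilinear form `(df(x), dg(x)) ↦ Γ(f, g)(x)` on `T_x^* M` is positive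
definite for every `x`. -/
def IsNondegenerate (Γ : SmoothFn n M →ₗ[ℝ] SmoothFn n M →ₗ[ℝ] SmoothFn n M) : Prop :=
  ∀ (f : SmoothFn n M) (x : M), mfderiv (𝓡 n) 𝓘(ℝ, ℝ) f x ≠ 0 → 0 < Γ f f x

variable [IsManifold (𝓡 n) ∞ M]

theorem exists_gradient (g : SmoothMetric n M) (f : M → ℝ) (x : M) :
    ∃ v : TangentSpace (𝓡 n) x, ∀ w : TangentSpace (𝓡 n) x,
      g.inner x v w = mfderiv (𝓡 n) 𝓘(ℝ, ℝ) f x w := by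
  have : FiniteDimensional ℝ (TangentSpace (𝓡 n) x) :=
    inferInstanceAs (FiniteDimensional ℝ (EuclideanSpace ℝ (Fin n)))
  let B : TangentSpace (𝓡 n) x →ₗ[ℝ] Module.Dual ℝ (TangentSpace (𝓡 n) x) :=
    { toFun := fun v => (g.inner x v).toLinearMap
      map_add' := fun a b => by ext w; simp
      map_smul' := fun a b => by ext w; simp }
  have hinj : Function.Injective B := by
    rw [injective_iff_map_eq_zero]
    intro v hv
    by_contra hne
    have h1 := g.pos x v hne
    have h2 : g.inner x v v = 0 := by
      have := congrArg (fun l : Module.Dual ℝ (TangentSpace (𝓡 n) x) => l v) hv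
      simpa [B] using this
    exact absurd h2 h1.ne'
  have hsurj : Function.Surjective B :=
    (LinearMap.injective_iff_surjective_of_finrank_eq_finrank
      (Subspace.dual_finrank_eq (K := ℝ) (V := TangentSpace (𝓡 n) x)).symm).1 hinj
  obtain ⟨v, hv⟩ := hsurj ((mfderiv (𝓡 n) 𝓘(ℝ, ℝ) f x).toLinearMap)
  exact ⟨v, fun w => congrArg (fun l : Module.Dual ℝ (TangentSpace (𝓡 n) x) => l w) hv⟩

/-- The `g`-gradient: `g(∇f, w) = df(w)` for all tangent vectors `w`. -/
def grad (g : SmoothMetric n M) (f : M → ℝ) (x : M) : TangentSpace (𝓡 n) x :=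
  (exists_gradient g f x).choose

/-- `Γ(f, h) = ⟨∇f, ∇h⟩_g = ⟨df, dh⟩_{g⁻¹}` for all smooth `f, h`. -/
def IsMetricOf (Γ : SmoothFn n M →ₗ[ℝ] SmoothFn n M →ₗ[ℝ] SmoothFn n M)
    (g : SmoothMetric n M) : Prop :=
  ∀ (f h : SmoothFn n M) (x : M), Γ f h x = g.inner x (grad g f x) (grad g h x)

/-- The standard basis of the coordinate space. -/
def stdVec (i : Fin n) : EuclideanSpace ℝ (Fin n) := EuclideanSpace.single i 1

/-- The coordinate vector field `∂_i` of the chart `e`, at the point with coordinates `y`. -/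
def coordVec (e : OpenPartialHomeomorph M (EuclideanSpace ℝ (Fin n)))
    (y : EuclideanSpace ℝ (Fin n)) (i : Fin n) : TangentSpace (𝓡 n) (e.symm y) :=
  mfderiv 𝓘(ℝ, EuclideanSpace ℝ (Fin n)) (𝓡 n) e.symm y (stdVec i)

/-- The matrix `(g_ij)` of the metric in the chart `e`, as a function of the coordinates. -/
def metricMatrix (g : SmoothMetric n M) (e : OpenPartialHomeomorph M (EuclideanSpace ℝ (Fin n)))
    (y : EuclideanSpace ℝ (Fin n)) : Matrix (Fin n) (Fin n) ℝ :=
  Matrix.of fun i j => g.inner (e.symm y) (coordVec e y i) (coordVec e y j)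

/-- `√(det (g_ij))` in the chart `e`. -/
def volDensity (g : SmoothMetric n M) (e : OpenPartialHomeomorph M (EuclideanSpace ℝ (Fin n)))
    (y : EuclideanSpace ℝ (Fin n)) : ℝ :=
  Real.sqrt (metricMatrix g e y).det

/-- The partial derivative `∂_i F`. -/
def partialD (i : Fin n) (F : EuclideanSpace ℝ (Fin n) → ℝ) (y : EuclideanSpace ℝ (Fin n)) : ℝ :=
  fderiv ℝ F y (stdVec i)

/-- The Laplace--Beltrami operator
`Δ_g f = (det g)^{-1/2} ∑_i ∂_i ((det g)^{1/2} ∑_j g^{ij} ∂_j f)`,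
computed at `x` in the preferred chart at `x`. -/
def laplaceBeltrami (g : SmoothMetric n M) (f : M → ℝ) (x : M) : ℝ :=
  let e := chartAt (EuclideanSpace ℝ (Fin n)) x
  (volDensity g e (e x))⁻¹ * ∑ i : Fin n, partialD i (fun y =>
    volDensity g e y * ∑ j : Fin n, (metricMatrix g e y)⁻¹ i j * partialD j (f ∘ e.symm) y) (e x)

theorem exists_chart_cover (n : ℕ) (M : Type*) [TopologicalSpace M]
    [ChartedSpace (EuclideanSpace ℝ (Fin n)) M] [SecondCountableTopology M] [Nonempty M] :
    ∃ c : ℕ → M, ⋃ k, (chartAt (EuclideanSpace ℝ (Fin n)) (c k)).source = univ := by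
  obtain ⟨s, hs, hU⟩ := TopologicalSpace.countable_cover_nhds
    (fun x : M => (chartAt (EuclideanSpace ℝ (Fin n)) x).open_source.mem_nhds
      (mem_chart_source (EuclideanSpace ℝ (Fin n)) x))
  have hne : s.Nonempty := by
    by_contra h
    rw [Set.not_nonempty_iff_eq_empty] at h
    simp [h] at hU
    exact absurd hU.symm (Set.univ_nonempty.ne_empty)
  obtain ⟨c, rfl⟩ := hs.exists_eq_range hne
  exact ⟨c, by simpa using hU⟩

/-- A sequence of preferred charts whose domains cover `M`. -/
def coverChart (n : ℕ) (M : Type*) [TopologicalSpace M]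
    [ChartedSpace (EuclideanSpace ℝ (Fin n)) M] [SecondCountableTopology M] [Nonempty M] (k : ℕ) :
    OpenPartialHomeomorph M (EuclideanSpace ℝ (Fin n)) :=
  chartAt (EuclideanSpace ℝ (Fin n)) ((exists_chart_cover n M).choose k)

/-- The Riemannian volume measure. The charts `e_k` of a countable cover are made disjoint:
`D_k = dom(e_k) \ (dom(e_0) ∪ ⋯ ∪ dom(e_{k-1}))`, and
`vol_g(A) = ∑_k ∫_{e_k(A ∩ D_k)} √(det (g_ij)) dy`. -/
def riemannianVolume [SecondCountableTopology M] [Nonempty M] [MeasurableSpace M]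
    (g : SmoothMetric n M) : Measure M :=
  Measure.sum fun k =>
    (Measure.map (coverChart n M k).symm
      ((volume.restrict (coverChart n M k).target).withDensity
        (fun y => ENNReal.ofReal (volDensity g (coverChart n M k) y)))).restrict
    (disjointed (fun j => (coverChart n M j).source) k)

/-- The weighted Laplacian `Δ_g f + ⟨∇ log ρ, ∇ f⟩_g`. -/
def weightedLaplacian (g : SmoothMetric n M) (ρ : M → ℝ) (f : M → ℝ) (x : M) : ℝ :=
  laplaceBeltrami g f x + g.inner x (grad g (fun y => Real.log (ρ y)) x) (grad g f x)

end Manifold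

end

/-!
In the coordinates `x_i` of a chart, a first-order symmetric `Γ` is given by the matrix
`Γ(x_i, x_j)`, through `Γ(f, h) = ∑ Γ(x_i, x_j) ∂_i f ∂_j h`. Nondegeneracy makes it positive definite,
and the inverse matrix is the only possible metric. It does not depend on the chart, because the
form it defines pairs the `Γ`-gradient of `f` with `w` to `df(w)` (`IsCometric.coordForm_inv`,
`IsCometric.exists_isMetricOf`, `IsCometric.metric_unique`).

The densities of a smooth positive measure in charts and the volume densities `√(det (g_ij))`
are both multiplied by the absolute Jacobian determinant under a change of charts, so that their
quotient is a smooth positive function `ρ` on `M` (`IsMetricOf.exists_chartDensity`).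

The generator is identified weakly. If `f`, `h` and `f h` are in its domain, the limit defining
`Γ` gives `2 Γ(f, h) = L(f h) - f L h - h L f`. Integrated against a cutoff function that is `1`
near the supports, the term `L(f h)` contributes nothing by strong locality, and the symmetry of
`L` leaves `⟨L f, h⟩ = -∫ Γ(f, h) dμ` (`integral_generator_mul`). Green's formula in charts
(`IsChartDensity.integral_chartLaplacian`) gives the same for the weighted Laplacian in
divergence form `w⁻¹ ∑ ∂_i (w g^{ij} ∂_j f)`, `w = ρ √(det (g_ij))`, so that the two operators
agree almost everywhere (`generator_ae_eq_weightedLaplacian`).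

Both uniqueness statements up to constants reduce to the fact that a smooth `θ` with
`Γ(f, θ) = 0` for all test functions `f` has `dθ = 0` by nondegeneracy and is constant as `M` is connected
(`IsCometric.eq_const_of_forall_eq_zero`). For two weights that define the same operator,
`θ = log σ - log ρ` (`eq_mul_of_generator_eq`). For a second symmetrizing measure, `ν = θ μ`; the
symmetry with respect to `ν` says that `∫ h Γ(f, θ) dμ` is symmetric in `f` and `h`, and the
Leibniz rule then makes it vanish (`carreDuChamp_eq_zero_of_symm`, `eq_smul_of_symmetrizing`).
-/

noncomputable section

/-! ### Coordinates and differentials -/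

notation "chart[" n "]" => chartAt (EuclideanSpace ℝ (Fin n))

section Coordinates

variable {n : ℕ} {M : Type*} [TopologicalSpace M] [ChartedSpace (EuclideanSpace ℝ (Fin n)) M]

theorem fderiv_apply_eq_sum_partialD (F : EuclideanSpace ℝ (Fin n) → ℝ)
    (y v : EuclideanSpace ℝ (Fin n)) : fderiv ℝ F y v = ∑ i, partialD i F y * v i := by
  have hv : v = ∑ i, v i • stdVec i := by
    ext j
    simp [stdVec, Finset.sum_apply, Pi.single_apply]
  conv_lhs => rw [hv]
  simp [partialD, mul_comm]

theorem partialD_coord (i j : Fin n) (y : EuclideanSpace ℝ (Fin n)) :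
    partialD i (fun z => z j) y = if i = j then 1 else 0 := by
  have : fderiv ℝ (fun z : EuclideanSpace ℝ (Fin n) => z j) y = EuclideanSpace.proj j :=
    (EuclideanSpace.proj (𝕜 := ℝ) j).fderiv
  rw [partialD, this]
  simp [stdVec, eq_comm]

/-- The differential at `x` of the preferred chart at `c`, with values in the coordinate space. -/
def chartDeriv (n : ℕ) {M : Type*} [TopologicalSpace M] [ChartedSpace (EuclideanSpace ℝ (Fin n)) M]
    (c x : M) : TangentSpace (𝓡 n) x →L[ℝ] EuclideanSpace ℝ (Fin n) :=
  mfderiv (𝓡 n) (𝓡 n) (chart[n] c) x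

theorem SmoothFn.mdifferentiableAt (f : SmoothFn n M) (x : M) :
    MDifferentiableAt (𝓡 n) 𝓘(ℝ, ℝ) f x :=
  f.contMDiff.mdifferentiableAt (by simp)

theorem SmoothFn.smul_apply (a : ℝ) (f : SmoothFn n M) (x : M) : (a • f) x = a * f x := rfl

theorem SmoothFn.mul_apply (f h : SmoothFn n M) (x : M) : (f * h) x = f x * h x := rfl

theorem SmoothFn.coe_sum {ι : Type*} (s : Finset ι) (F : ι → SmoothFn n M) (x : M) :
    (∑ i ∈ s, F i) x = ∑ i ∈ s, F i x := by
  classical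
  induction s using Finset.induction_on with
  | empty => simp
  | insert i s hi ih => rw [Finset.sum_insert hi, Finset.sum_insert hi, ← ih]; rfl

/-- The coordinate representation of a function that agrees with the `j`-th coordinate near `x`
has the standard partial derivatives at `x`. -/
theorem partialD_of_eventuallyEq_coord {f : M → ℝ} {c x : M} (hx : x ∈ (chart[n] c).source)
    {j : Fin n} (hf : f =ᶠ[𝓝 x] fun z => chart[n] c z j) (i : Fin n) :
    partialD i (f ∘ (chart[n] c).symm) (chart[n] c x) = if i = j then 1 else 0 := by
  have hmem := (chart[n] c).map_source hx
  have h : f ∘ (chart[n] c).symm =ᶠ[𝓝 (chart[n] c x)] fun z => z j := by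
    have ht : Tendsto (chart[n] c).symm (𝓝 (chart[n] c x)) (𝓝 x) := by
      have := (chart[n] c).continuousAt_symm hmem
      rwa [ContinuousAt, (chart[n] c).left_inv hx] at this
    filter_upwards [ht.eventually hf, (chart[n] c).open_target.mem_nhds hmem] with z hz hz'
    rw [Function.comp_apply, hz, (chart[n] c).right_inv hz']
  rw [partialD, h.fderiv_eq]
  exact partialD_coord i j _

variable [IsManifold (𝓡 n) ∞ M]

theorem contMDiffOn_chart_symm_top (c : M) :
    ContMDiffOn 𝓘(ℝ, EuclideanSpace ℝ (Fin n)) (𝓡 n) ∞ (chart[n] c).symm (chart[n] c).target :=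
  contMDiffOn_chart_symm

theorem contDiffOn_comp_chart_symm {f : M → ℝ} {c : M}
    (hf : ContMDiffOn (𝓡 n) 𝓘(ℝ, ℝ) ∞ f (chart[n] c).source) :
    ContDiffOn ℝ ∞ (f ∘ (chart[n] c).symm) (chart[n] c).target := by
  rw [← contMDiffOn_iff_contDiffOn]
  exact hf.comp (contMDiffOn_chart_symm_top c) fun y hy => (chart[n] c).map_target hy

theorem contMDiffOn_comp_chart {F : EuclideanSpace ℝ (Fin n) → ℝ} {c : M}
    (hF : ContDiffOn ℝ ∞ F (chart[n] c).target) :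
    ContMDiffOn (𝓡 n) 𝓘(ℝ, ℝ) ∞ (F ∘ chart[n] c) (chart[n] c).source :=
  hF.contMDiffOn.comp contMDiffOn_chart fun _ hy => (chart[n] c).map_source hy

theorem chart_mdifferentiable (c : M) : (chart[n] c).MDifferentiable (𝓡 n) (𝓡 n) :=
  haveI : IsManifold (𝓡 n) 1 M := .of_le (n := ∞) (by simp)
  mdifferentiable_chart c

theorem mfderiv_apply_chart {f : M → ℝ} {c x : M} (hx : x ∈ (chart[n] c).source)
    (hf : MDifferentiableAt (𝓡 n) 𝓘(ℝ, ℝ) f x) (v : TangentSpace (𝓡 n) x) :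
    mfderiv (𝓡 n) 𝓘(ℝ, ℝ) f x v =
      fderiv ℝ (f ∘ (chart[n] c).symm) (chart[n] c x)
        (chartDeriv n c x v) := by
  have he := chart_mdifferentiable (n := n) c
  have h1 : f =ᶠ[𝓝 x] (f ∘ (chart[n] c).symm) ∘ chart[n] c := by
    filter_upwards [(chart[n] c).open_source.mem_nhds hx] with z hz
    simp [(chart[n] c).left_inv hz]
  have hd : MDifferentiableAt 𝓘(ℝ, EuclideanSpace ℝ (Fin n)) 𝓘(ℝ, ℝ)
      (f ∘ (chart[n] c).symm) (chart[n] c x) := by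
    refine MDifferentiableAt.comp _ ?_ (he.mdifferentiableAt_symm ((chart[n] c).map_source hx))
    rwa [(chart[n] c).left_inv hx]
  rw [h1.mfderiv_eq, mfderiv_comp x hd (he.mdifferentiableAt hx), ← mfderiv_eq_fderiv]
  rfl

theorem mfderiv_coordVec {f : M → ℝ} {c : M} {y : EuclideanSpace ℝ (Fin n)}
    (hy : y ∈ (chart[n] c).target)
    (hf : MDifferentiableAt (𝓡 n) 𝓘(ℝ, ℝ) f ((chart[n] c).symm y)) (i : Fin n) :
    mfderiv (𝓡 n) 𝓘(ℝ, ℝ) f ((chart[n] c).symm y) (coordVec (chart[n] c) y i) =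
      partialD i (f ∘ (chart[n] c).symm) y := by
  have he := chart_mdifferentiable (n := n) c
  rw [partialD, ← mfderiv_eq_fderiv, mfderiv_comp y hf (he.mdifferentiableAt_symm hy)]
  rfl

theorem chartDeriv_coordVec {c : M} {y : EuclideanSpace ℝ (Fin n)}
    (hy : y ∈ (chart[n] c).target) (i : Fin n) :
    chartDeriv n c ((chart[n] c).symm y) (coordVec (chart[n] c) y i) = stdVec i := by
  have := (chart_mdifferentiable (n := n) c).comp_symm_deriv hy
  exact congrArg (fun L => L (stdVec i)) this

theorem chartDeriv_injective {c x : M} (hx : x ∈ (chart[n] c).source) :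
    Function.Injective (chartDeriv n c x) :=
  (chart_mdifferentiable (n := n) c).mfderiv_injective hx

theorem chartDeriv_surjective {c x : M} (hx : x ∈ (chart[n] c).source) :
    Function.Surjective (chartDeriv n c x) :=
  (chart_mdifferentiable (n := n) c).mfderiv_surjective hx

theorem chartDeriv_sum_coordVec {c : M} {y : EuclideanSpace ℝ (Fin n)}
    (hy : y ∈ (chart[n] c).target) (a : Fin n → ℝ) :
    chartDeriv n c _ (∑ i, a i • coordVec (chart[n] c) y i) = WithLp.toLp 2 a := by
  rw [map_sum]
  simp_rw [map_smul, chartDeriv_coordVec hy]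
  ext j
  simp [stdVec, Finset.sum_apply, Pi.single_apply]

/-- Every tangent vector is a combination of coordinate vectors. -/
theorem eq_sum_coordVec {c : M} {y : EuclideanSpace ℝ (Fin n)}
    (hy : y ∈ (chart[n] c).target) (v : TangentSpace (𝓡 n) ((chart[n] c).symm y)) :
    ∃ a : Fin n → ℝ, v = ∑ i, a i • coordVec (chart[n] c) y i := by
  refine ⟨fun i => chartDeriv n c _ v i,
    chartDeriv_injective ((chart[n] c).map_target hy) ?_⟩
  rw [chartDeriv_sum_coordVec hy]

theorem SmoothFn.differentiableAt_comp_chart_symm (f : SmoothFn n M) {c : M}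
    {y : EuclideanSpace ℝ (Fin n)} (hy : y ∈ (chart[n] c).target) :
    DifferentiableAt ℝ (f ∘ (chart[n] c).symm) y :=
  ((contDiffOn_comp_chart_symm f.contMDiff.contMDiffOn).contDiffAt
    ((chart[n] c).open_target.mem_nhds hy)).differentiableAt (by simp)

theorem mfderiv_eq_sum_partialD (f : SmoothFn n M) {c x : M} (hx : x ∈ (chart[n] c).source)
    (v : TangentSpace (𝓡 n) x) :
    mfderiv (𝓡 n) 𝓘(ℝ, ℝ) f x v = ∑ i, partialD i (f ∘ (chart[n] c).symm) (chart[n] c x) *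
      chartDeriv n c x v i := by
  rw [mfderiv_apply_chart hx (f.mdifferentiableAt x), fderiv_apply_eq_sum_partialD]

/-- Differentials at a point agree as soon as the partial derivatives in one chart agree. -/
theorem mfderiv_eq_of_partialD_eq {f h : SmoothFn n M} {c x : M} (hx : x ∈ (chart[n] c).source)
    (hfh : ∀ i, partialD i (f ∘ (chart[n] c).symm) (chart[n] c x) =
      partialD i (h ∘ (chart[n] c).symm) (chart[n] c x)) (v : TangentSpace (𝓡 n) x) :
    mfderiv (𝓡 n) 𝓘(ℝ, ℝ) f x v = mfderiv (𝓡 n) 𝓘(ℝ, ℝ) h x v := by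
  rw [mfderiv_eq_sum_partialD f hx, mfderiv_eq_sum_partialD h hx]
  exact Finset.sum_congr rfl fun i _ => by rw [hfh i]

theorem exists_smoothFn_eventuallyEq [T2Space M] {U : Set M} (hU : IsOpen U) {p : M} (hp : p ∈ U)
    {F : M → ℝ} (hF : ContMDiffOn (𝓡 n) 𝓘(ℝ, ℝ) ∞ F U) :
    ∃ f : SmoothFn n M, HasCompactSupport f ∧ tsupport f ⊆ U ∧ f =ᶠ[𝓝 p] F := by
  obtain ⟨b, -, hb⟩ := (SmoothBumpFunction.nhds_basis_tsupport (I := 𝓡 n) p).mem_iff.1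
    (hU.mem_nhds hp)
  have hts : tsupport (fun x => b x * F x) ⊆ tsupport b := tsupport_mul_subset_left
  refine ⟨⟨fun x => b x * F x, contMDiff_of_tsupport fun x hx => ?_⟩, ?_, hts.trans hb, ?_⟩
  · exact b.contMDiffAt.mul (hF.contMDiffAt (hU.mem_nhds (hb (hts hx))))
  · exact b.hasCompactSupport.mul_right
  · filter_upwards [b.eventuallyEq_one] with x hx
    change b x * F x = F x
    rw [hx]
    simp

/-- The `i`-th coordinate of a chart, cut off to a smooth function on `M`. -/
theorem exists_smoothFn_coord [T2Space M] {c p : M} (hp : p ∈ (chart[n] c).source) (i : Fin n) :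
    ∃ f : SmoothFn n M, f =ᶠ[𝓝 p] fun x => chart[n] c x i := by
  have h : ContMDiffOn (𝓡 n) 𝓘(ℝ, ℝ) ∞ (fun x => chart[n] c x i) (chart[n] c).source :=
    contMDiffOn_comp_chart (n := n) (F := fun y => y i)
      (EuclideanSpace.proj (𝕜 := ℝ) i).contDiff.contDiffOn
  obtain ⟨f, -, -, hf⟩ := exists_smoothFn_eventuallyEq (chart[n] c).open_source hp h
  exact ⟨f, hf⟩

theorem exists_smoothFn_eq_one [T2Space M] [SecondCountableTopology M] {K U : Set M}
    (hK : IsCompact K) (hU : IsOpen U) (hKU : K ⊆ U) :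
    ∃ (χ : SmoothFn n M) (V : Set M), HasCompactSupport χ ∧ tsupport χ ⊆ U ∧ IsOpen V ∧ K ⊆ V ∧
      ∀ x ∈ V, χ x = 1 := by
  have : LocallyCompactSpace M := ChartedSpace.locallyCompactSpace (EuclideanSpace ℝ (Fin n)) M
  obtain ⟨L, hL, hKL, hLU⟩ := exists_compact_between hK hU hKU
  obtain ⟨χ, h1, h0, -⟩ := exists_contMDiffMap_one_nhds_of_subset_interior (n := ⊤) (𝓡 n)
    hK.isClosed hKL
  have hts : tsupport χ ⊆ L := closure_minimal
    (fun x hx => by_contra fun h => hx (h0 x h)) hL.isClosed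
  obtain ⟨V, hV, hKV, hV1⟩ := mem_nhdsSet_iff_exists.1 h1
  exact ⟨χ, V, hL.of_isClosed_subset (isClosed_tsupport _) hts, hts.trans hLU, hV, hKV,
    fun x hx => hV1 hx⟩

end Coordinates

/-! ### Matrices and bilinear forms -/

section LinearAlgebra

open Matrix

variable {n : ℕ}

theorem contDiffAt_det {E : Type*} [NormedAddCommGroup E] [NormedSpace ℝ E]
    {A : E → Matrix (Fin n) (Fin n) ℝ} {y : E}
    (hA : ∀ k l, ContDiffAt ℝ ∞ (fun z => A z k l) y) : ContDiffAt ℝ ∞ (fun z => (A z).det) y := by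
  simp only [Matrix.det_apply, Units.smul_def, zsmul_eq_mul]
  exact ContDiffAt.sum fun σ _ => contDiffAt_const.mul (contDiffAt_prod fun k _ => hA _ _)

theorem contDiffAt_matrix_inv_entry {A : Matrix (Fin n) (Fin n) ℝ} (hA : A.det ≠ 0) (i j : Fin n) :
    ContDiffAt ℝ ∞ (fun B : Fin n → Fin n → ℝ => (Matrix.of B)⁻¹ i j) A := by
  have hent : ∀ k l, ContDiffAt ℝ ∞ (fun B : Fin n → Fin n → ℝ => B k l) A := fun k l => by
    fun_prop
  have hadj : ContDiffAt ℝ ∞ (fun B : Fin n → Fin n → ℝ => (Matrix.of B).adjugate i j) A := by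
    simp only [Matrix.adjugate_apply]
    refine contDiffAt_det fun k l => ?_
    simp only [Matrix.updateRow_apply, Matrix.of_apply]
    split_ifs
    · exact contDiffAt_const
    · exact hent k l
  simp only [Matrix.inv_def, Ring.inverse_eq_inv', Matrix.smul_apply, smul_eq_mul]
  exact ((contDiffAt_det hent).inv hA).mul hadj

/-- The bilinear form with matrix `A` in the linear coordinates `L`. -/
def coordForm {V : Type*} [TopologicalSpace V] [AddCommGroup V] [Module ℝ V]
    [IsTopologicalAddGroup V] [ContinuousSMul ℝ V]
    (A : Matrix (Fin n) (Fin n) ℝ) (L : V →L[ℝ] EuclideanSpace ℝ (Fin n)) : V →L[ℝ] V →L[ℝ] ℝ :=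
  ∑ i, ∑ j, A i j • ((EuclideanSpace.proj (𝕜 := ℝ) i).comp L).smulRight
    ((EuclideanSpace.proj (𝕜 := ℝ) j).comp L)

theorem coordForm_apply {V : Type*} [TopologicalSpace V] [AddCommGroup V] [Module ℝ V]
    [IsTopologicalAddGroup V] [ContinuousSMul ℝ V]
    (A : Matrix (Fin n) (Fin n) ℝ) (L : V →L[ℝ] EuclideanSpace ℝ (Fin n)) (v w : V) :
    coordForm A L v w = (L v).ofLp ⬝ᵥ (A *ᵥ (L w).ofLp) := by
  simp only [coordForm, _root_.sum_apply, _root_.smul_apply,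
    ContinuousLinearMap.smulRight_apply, ContinuousLinearMap.comp_apply, dotProduct, Matrix.mulVec,
    smul_eq_mul, Finset.mul_sum, PiLp.proj_apply]
  exact Finset.sum_congr rfl fun i _ => Finset.sum_congr rfl fun j _ => by ring

/-- The unit ball of a positive definite form is bounded, by compactness of the unit sphere. Bundled
Riemannian metrics require this of each fibre. -/
theorem isVonNBounded_of_pos {E : Type*} [NormedAddCommGroup E] [NormedSpace ℝ E]
    [FiniteDimensional ℝ E] (B : E →L[ℝ] E →L[ℝ] ℝ) (hB : ∀ v, v ≠ 0 → 0 < B v v) :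
    Bornology.IsVonNBounded ℝ {v : E | B v v < 1} := by
  obtain ⟨m, hm, hmin⟩ := (isCompact_sphere (0 : E) 1).exists_forall_le' (f := fun v => B v v)
    (by fun_prop) (a := 0) fun v hv => hB v (ne_zero_of_mem_unit_sphere ⟨v, hv⟩)
  rw [NormedSpace.isVonNBounded_iff, isBounded_iff_forall_norm_le]
  refine ⟨√(1 / m), fun v hv => ?_⟩
  rcases eq_or_ne v 0 with rfl | hv0
  · simp
  have hn : 0 < ‖v‖ := norm_pos_iff.2 hv0
  have h1 := hmin (‖v‖⁻¹ • v) (by simp [norm_smul, hn.ne'])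
  have h2 : B (‖v‖⁻¹ • v) (‖v‖⁻¹ • v) = (‖v‖ ^ 2)⁻¹ * B v v := by
    simp
    ring
  rw [h2, inv_mul_eq_div, le_div_iff₀ (by positivity)] at h1
  refine Real.le_sqrt_of_sq_le ?_
  rw [le_div_iff₀ hm]
  have : B v v < 1 := hv
  linarith

end LinearAlgebra

/-! ### The carré du champ in coordinates -/

section Cometric

open Matrix

variable {n : ℕ} {M : Type*} [TopologicalSpace M] [ChartedSpace (EuclideanSpace ℝ (Fin n)) M]

/-- The coordinate vector of the differential `df(x)` in the preferred chart at `c`. -/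
def partials (n : ℕ) {M : Type*} [TopologicalSpace M] [ChartedSpace (EuclideanSpace ℝ (Fin n)) M]
    (c x : M) (f : M → ℝ) : Fin n → ℝ :=
  fun i => partialD i (f ∘ (chart[n] c).symm) (chart[n] c x)

/-- The functions `X i` have the germs at `x` of the coordinates of the preferred chart at `c`. -/
def IsCoordGerm (c x : M) (X : Fin n → SmoothFn n M) : Prop :=
  ∀ i, X i =ᶠ[𝓝 x] fun z => chart[n] c z i

/-- The matrix `Γ(X i, X j)(x)`. -/
def carreMatrix (Γ : SmoothFn n M →ₗ[ℝ] SmoothFn n M →ₗ[ℝ] SmoothFn n M)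
    (X : Fin n → SmoothFn n M) (x : M) : Matrix (Fin n) (Fin n) ℝ :=
  Matrix.of fun i j => Γ (X i) (X j) x

theorem IsCoordGerm.eventually {c x : M} {X : Fin n → SmoothFn n M} (hX : IsCoordGerm c x X) :
    ∀ᶠ z in 𝓝 x, IsCoordGerm c z X :=
  eventually_all.2 fun i => eventually_eventually_nhds.2 (hX i)

variable [IsManifold (𝓡 n) ∞ M]

theorem mfderiv_eq_dotProduct (f : SmoothFn n M) {c x : M} (hx : x ∈ (chart[n] c).source)
    (v : TangentSpace (𝓡 n) x) :
    mfderiv (𝓡 n) 𝓘(ℝ, ℝ) f x v = partials n c x f ⬝ᵥ (chartDeriv n c x v).ofLp :=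
  mfderiv_eq_sum_partialD f hx v

theorem exists_isCoordGerm [T2Space M] {c x : M} (hx : x ∈ (chart[n] c).source) :
    ∃ X : Fin n → SmoothFn n M, IsCoordGerm c x X := by
  choose X hX using exists_smoothFn_coord (n := n) hx
  exact ⟨X, hX⟩

theorem partials_sum_smul {c x : M} {X : Fin n → SmoothFn n M} (hx : x ∈ (chart[n] c).source)
    (hX : IsCoordGerm c x X) (a : Fin n → ℝ) :
    partials n c x (∑ j, a j • X j : SmoothFn n M) = a := by
  funext i
  have hy := (chart[n] c).map_source hx
  have h : ((∑ j, a j • X j : SmoothFn n M) : M → ℝ) ∘ (chart[n] c).symm =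
      fun y => ∑ j, a j * (X j ∘ (chart[n] c).symm) y := by
    funext y
    simp only [Function.comp_apply, SmoothFn.coe_sum]
    rfl
  rw [partials, h, partialD, fderiv_fun_sum
    fun j _ => ((X j).differentiableAt_comp_chart_symm hy).const_mul (a j)]
  simp only [_root_.sum_apply]
  have : ∀ j, fderiv ℝ (fun y => a j * (X j ∘ (chart[n] c).symm) y) (chart[n] c x) (stdVec i) =
      a j * if i = j then 1 else 0 := fun j => by
    rw [fderiv_const_mul ((X j).differentiableAt_comp_chart_symm hy)]
    rw [← partialD_of_eventuallyEq_coord hx (hX j) i]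
    rfl
  rw [Finset.sum_congr rfl fun j _ => this j]
  simp

/-- What the recovery of the metric uses of a carré du champ: it is symmetric, first order and
non-degenerate. -/
structure IsCometric (Γ : SmoothFn n M →ₗ[ℝ] SmoothFn n M →ₗ[ℝ] SmoothFn n M) : Prop where
  symm : ∀ f g, Γ f g = Γ g f
  first_order : ∀ (f f' g g' : SmoothFn n M) (x : M),
    (∀ v : TangentSpace (𝓡 n) x,
      mfderiv (𝓡 n) 𝓘(ℝ, ℝ) f x v = mfderiv (𝓡 n) 𝓘(ℝ, ℝ) f' x v) →
    (∀ v : TangentSpace (𝓡 n) x,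
      mfderiv (𝓡 n) 𝓘(ℝ, ℝ) g x v = mfderiv (𝓡 n) 𝓘(ℝ, ℝ) g' x v) →
    Γ f g x = Γ f' g' x
  pos : IsNondegenerate Γ

variable {Γ : SmoothFn n M →ₗ[ℝ] SmoothFn n M →ₗ[ℝ] SmoothFn n M}

/-- As `Γ` is first order, `f` and `h` may be replaced by linear combinations of the coordinates
with the same differentials. -/
theorem IsCometric.eq_dotProduct (hΓ : IsCometric Γ) {c x : M} (hx : x ∈ (chart[n] c).source)
    {X : Fin n → SmoothFn n M} (hX : IsCoordGerm c x X) (f h : SmoothFn n M) :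
    Γ f h x = partials n c x f ⬝ᵥ (carreMatrix Γ X x *ᵥ partials n c x h) := by
  rw [hΓ.first_order f (∑ i, partials n c x f i • X i) h (∑ j, partials n c x h j • X j) x
    (mfderiv_eq_of_partialD_eq hx fun i =>
      (congrFun (partials_sum_smul hx hX (partials n c x f)) i).symm)
    (mfderiv_eq_of_partialD_eq hx fun i =>
      (congrFun (partials_sum_smul hx hX (partials n c x h)) i).symm)]
  simp only [map_sum, map_smul, LinearMap.sum_apply, LinearMap.smul_apply, SmoothFn.coe_sum,
    SmoothFn.smul_apply, dotProduct, Matrix.mulVec, carreMatrix, Matrix.of_apply, Finset.mul_sum]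
  rw [Finset.sum_comm]
  refine Finset.sum_congr rfl fun i _ => Finset.sum_congr rfl fun j _ => ?_
  ring

theorem IsCometric.carreMatrix_posDef (hΓ : IsCometric Γ) {c x : M}
    (hx : x ∈ (chart[n] c).source) {X : Fin n → SmoothFn n M} (hX : IsCoordGerm c x X) :
    (carreMatrix Γ X x).PosDef := by
  refine Matrix.PosDef.of_dotProduct_mulVec_pos ?_ fun a ha => ?_
  · ext i j
    simp [carreMatrix, hΓ.symm (X i) (X j)]
  have h := hΓ.eq_dotProduct hx hX (∑ j, a j • X j) (∑ j, a j • X j)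
  rw [partials_sum_smul hx hX] at h
  rw [star_trivial, ← h]
  refine hΓ.pos _ _ fun h0 => ha ?_
  funext i
  obtain ⟨v, hv⟩ := chartDeriv_surjective (n := n) hx (stdVec i)
  have h1 := mfderiv_eq_dotProduct (∑ j, a j • X j : SmoothFn n M) hx v
  rw [partials_sum_smul hx hX, hv, h0] at h1
  have h2 : (0 : ℝ) = a ⬝ᵥ (stdVec i).ofLp := h1
  simpa [stdVec] using h2.symm

theorem IsCometric.isUnit_det (hΓ : IsCometric Γ) {c x : M}
    (hx : x ∈ (chart[n] c).source) {X : Fin n → SmoothFn n M} (hX : IsCoordGerm c x X) :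
    IsUnit (carreMatrix Γ X x).det :=
  isUnit_iff_ne_zero.2 (hΓ.carreMatrix_posDef hx hX).det_pos.ne'

/-- Every tangent vector `v` is the `Γ`-gradient at `x` of some function. -/
theorem IsCometric.exists_potential [T2Space M] (hΓ : IsCometric Γ) (x : M)
    (v : TangentSpace (𝓡 n) x) :
    ∃ f : SmoothFn n M, ∀ h : SmoothFn n M, Γ f h x = mfderiv (𝓡 n) 𝓘(ℝ, ℝ) h x v := by
  have hx := mem_chart_source (EuclideanSpace ℝ (Fin n)) x
  obtain ⟨X, hX⟩ := exists_isCoordGerm (n := n) hx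
  refine ⟨∑ j, ((carreMatrix Γ X x)⁻¹ *ᵥ (chartDeriv n x x v).ofLp) j • X j, fun h => ?_⟩
  rw [hΓ.symm, hΓ.eq_dotProduct hx hX, partials_sum_smul hx hX, Matrix.mulVec_mulVec,
    Matrix.mul_nonsing_inv _ (hΓ.isUnit_det hx hX), Matrix.one_mulVec, mfderiv_eq_dotProduct h hx]

/-- Every differential at `x` is represented by a tangent vector through `Γ`. -/
theorem IsCometric.exists_gradient (hΓ : IsCometric Γ) [T2Space M] (f : SmoothFn n M) (x : M) :
    ∃ v : TangentSpace (𝓡 n) x, ∀ h : SmoothFn n M, Γ f h x = mfderiv (𝓡 n) 𝓘(ℝ, ℝ) h x v := by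
  have hx := mem_chart_source (EuclideanSpace ℝ (Fin n)) x
  obtain ⟨X, hX⟩ := exists_isCoordGerm (n := n) hx
  obtain ⟨v, hv⟩ := chartDeriv_surjective (n := n) hx
    (WithLp.toLp 2 (carreMatrix Γ X x *ᵥ partials n x x f))
  refine ⟨v, fun h => ?_⟩
  rw [hΓ.symm, hΓ.eq_dotProduct hx hX, mfderiv_eq_dotProduct h hx, hv]

/-- The inverse of the matrix of `Γ` is the matrix of the metric: the form it defines pairs `v`
with `w` to `df(w)`, where `f` is any function with `Γ`-gradient `v`. In particular it does not
depend on the coordinates. -/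
theorem IsCometric.coordForm_inv (hΓ : IsCometric Γ) {c x : M} (hx : x ∈ (chart[n] c).source)
    {X : Fin n → SmoothFn n M} (hX : IsCoordGerm c x X) {f : SmoothFn n M}
    {v : TangentSpace (𝓡 n) x}
    (hf : ∀ h : SmoothFn n M, Γ f h x = mfderiv (𝓡 n) 𝓘(ℝ, ℝ) h x v)
    (w : TangentSpace (𝓡 n) x) :
    coordForm (carreMatrix Γ X x)⁻¹ (chartDeriv n c x) v w = mfderiv (𝓡 n) 𝓘(ℝ, ℝ) f x w := by
  have h1 : partials n c x f ᵥ* carreMatrix Γ X x = (chartDeriv n c x v).ofLp := by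
    refine dotProduct_eq _ _ fun a => ?_
    have := hf (∑ j, a j • X j)
    rw [hΓ.eq_dotProduct hx hX, mfderiv_eq_dotProduct _ hx, partials_sum_smul hx hX] at this
    rw [← Matrix.dotProduct_mulVec, this, dotProduct_comm]
  rw [coordForm_apply, ← h1, Matrix.dotProduct_mulVec, Matrix.vecMul_vecMul,
    Matrix.mul_nonsing_inv _ (hΓ.isUnit_det hx hX), Matrix.vecMul_one, mfderiv_eq_dotProduct f hx]

end Cometric

/-! ### The metric of a carré du champ -/

section Metric

open Matrix

variable {n : ℕ} {M : Type*} [TopologicalSpace M] [ChartedSpace (EuclideanSpace ℝ (Fin n)) M]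
  [IsManifold (𝓡 n) ∞ M] {Γ : SmoothFn n M →ₗ[ℝ] SmoothFn n M →ₗ[ℝ] SmoothFn n M}

theorem contMDiffAt_carreMatrix_inv (hΓ : IsCometric Γ) {c x : M}
    (hx : x ∈ (chart[n] c).source) {X : Fin n → SmoothFn n M} (hX : IsCoordGerm c x X)
    (i j : Fin n) :
    ContMDiffAt (𝓡 n) 𝓘(ℝ, ℝ) ∞ (fun z => (carreMatrix Γ X z)⁻¹ i j) x := by
  have h1 := (contDiffAt_matrix_inv_entry (hΓ.isUnit_det hx hX).ne_zero i j).contMDiffAt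
  have h2 : ContMDiffAt (𝓡 n) 𝓘(ℝ, Fin n → Fin n → ℝ) ∞ (fun z k l => carreMatrix Γ X z k l) x := by
    simp only [contMDiffAt_pi_space]
    exact fun k l => (Γ (X k) (X l)).contMDiff.contMDiffAt
  exact h1.comp x h2

/-- The trivialization of the tangent bundle at `c` is given by the differential of the chart
at `c`. -/
theorem chartDeriv_trivializationAt_symm {c x : M} (hx : x ∈ (chart[n] c).source)
    (v : EuclideanSpace ℝ (Fin n)) :
    chartDeriv n c x ((trivializationAt (EuclideanSpace ℝ (Fin n)) (TangentSpace (𝓡 n)) c).symm x v)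
      = v := by
  have : IsManifold (𝓡 n) 1 M := .of_le (n := ∞) (by simp)
  have h1 : chartDeriv n c x = (trivializationAt (EuclideanSpace ℝ (Fin n))
      (TangentSpace (𝓡 n)) c).continuousLinearMapAt ℝ x := by
    rw [TangentBundle.continuousLinearMapAt_trivializationAt hx,
      (hasMFDerivAt_extChartAt hx).mfderiv]
    rfl
  rw [h1]
  rw [← Bundle.Trivialization.symmL_apply (R := ℝ) _ hx]
  exact (trivializationAt (EuclideanSpace ℝ (Fin n))
    (TangentSpace (𝓡 n)) c).continuousLinearMapAt_symmL (R := ℝ) hx v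

theorem metric_ext {g g' : SmoothMetric n M} (h : ∀ x v w, g.inner x v w = g'.inner x v w) :
    g = g' := by
  have h' : g.inner = g'.inner := by
    funext x
    ext v w
    exact h x v w
  cases g; cases g'; cases h'; rfl

/-- The inverse of the matrix of `Γ` in coordinates is a smooth Riemannian metric, for which every
`v` that represents `Γ(f, ·)` at `x` is the gradient of `f`. Each fibre uses the coordinates of its
own preferred chart; smoothness near `c` follows since the form is the same in the chart at `c`. -/
theorem IsCometric.exists_metric [T2Space M] (hΓ : IsCometric Γ) :
    ∃ g : SmoothMetric n M, ∀ (x : M) (v : TangentSpace (𝓡 n) x) (f : SmoothFn n M),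
      (∀ h : SmoothFn n M, Γ f h x = mfderiv (𝓡 n) 𝓘(ℝ, ℝ) h x v) →
      ∀ w, g.inner x v w = mfderiv (𝓡 n) 𝓘(ℝ, ℝ) f x w := by
  choose X hX using fun c : M =>
    exists_isCoordGerm (n := n) (mem_chart_source (EuclideanSpace ℝ (Fin n)) c)
  have hx := fun x : M => mem_chart_source (EuclideanSpace ℝ (Fin n)) x
  -- the same form in the coordinates centred at a nearby point
  have hnear : ∀ c : M, ∀ᶠ x in 𝓝 c, x ∈ (chart[n] c).source ∧
      coordForm (carreMatrix Γ (X x) x)⁻¹ (chartDeriv n x x) =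
        coordForm (carreMatrix Γ (X c) x)⁻¹ (chartDeriv n c x) := by
    intro c
    filter_upwards [(chart[n] c).open_source.mem_nhds (hx c), (hX c).eventually] with x hxc hXc
    refine ⟨hxc, ?_⟩
    ext v w
    obtain ⟨f, hf⟩ := hΓ.exists_potential x v
    rw [hΓ.coordForm_inv (hx x) (hX x) hf, hΓ.coordForm_inv hxc hXc hf]
  have hpos : ∀ (x : M) (v : TangentSpace (𝓡 n) x), v ≠ 0 →
      0 < coordForm (carreMatrix Γ (X x) x)⁻¹ (chartDeriv n x x) v v := by
    intro x v hv
    rw [coordForm_apply]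
    refine (hΓ.carreMatrix_posDef (hx x) (hX x)).inv.dotProduct_mulVec_pos fun h0 => hv ?_
    refine chartDeriv_injective (hx x) ?_
    rw [map_zero]
    ext i
    exact congrFun h0 i
  refine ⟨⟨fun x => coordForm (carreMatrix Γ (X x) x)⁻¹ (chartDeriv n x x), fun x v w => ?_, hpos,
    fun x => ?_, fun c => ?_⟩, fun x v f hf w => hΓ.coordForm_inv (hx x) (hX x) hf w⟩
  · rw [coordForm_apply, coordForm_apply, Matrix.dotProduct_mulVec, dotProduct_comm,
      ← Matrix.mulVec_transpose]
    have := (hΓ.carreMatrix_posDef (hx x) (hX x)).inv.isHermitian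
    rw [Matrix.IsHermitian, Matrix.conjTranspose_eq_transpose_of_trivial] at this
    rw [this]
  · exact isVonNBounded_of_pos (E := EuclideanSpace ℝ (Fin n)) _ (hpos x)
  · rw [contMDiffAt_hom_bundle]
    refine ⟨contMDiffAt_id, ?_⟩
    have hs : ContMDiffAt (𝓡 n)
        𝓘(ℝ, EuclideanSpace ℝ (Fin n) →L[ℝ] EuclideanSpace ℝ (Fin n) →L[ℝ] ℝ)
        ∞ (fun x => coordForm (carreMatrix Γ (X c) x)⁻¹
          (ContinuousLinearMap.id ℝ (EuclideanSpace ℝ (Fin n)))) c := by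
      unfold coordForm
      refine contMDiffAt_finsetSum fun i _ => contMDiffAt_finsetSum fun j _ => ?_
      exact (contMDiffAt_carreMatrix_inv hΓ (hx c) (hX c) i j).smul contMDiffAt_const
    refine hs.congr_of_eventuallyEq ?_
    filter_upwards [hnear c] with x hxc
    ext v w
    rw [inCoordinates_apply_eq₂ hxc.1 hxc.1 (mem_univ _)]
    simp only [hxc.2, coordForm_apply, chartDeriv_trivializationAt_symm hxc.1]
    simp [Bundle.Trivial.linearMapAt_trivialization]

theorem inner_grad (g : SmoothMetric n M) (f : M → ℝ) (x : M) (w : TangentSpace (𝓡 n) x) :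
    g.inner x (grad g f x) w = mfderiv (𝓡 n) 𝓘(ℝ, ℝ) f x w :=
  (exists_gradient g f x).choose_spec w

theorem eq_of_inner_eq (g : SmoothMetric n M) {x : M} {v v' : TangentSpace (𝓡 n) x}
    (h : ∀ w, g.inner x v w = g.inner x v' w) : v = v' := by
  by_contra hne
  have h1 := g.pos x (v - v') (sub_ne_zero.2 hne)
  have h2 : g.inner x (v - v') (v - v') = g.inner x v (v - v') - g.inner x v' (v - v') := by
    rw [(g.inner x).map_sub]
    rfl
  rw [h2, h, sub_self] at h1
  exact lt_irrefl _ h1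

theorem eq_of_mfderiv_eq [T2Space M] {x : M} {v v' : TangentSpace (𝓡 n) x}
    (h : ∀ f : SmoothFn n M, mfderiv (𝓡 n) 𝓘(ℝ, ℝ) f x v = mfderiv (𝓡 n) 𝓘(ℝ, ℝ) f x v') :
    v = v' := by
  have hx := mem_chart_source (EuclideanSpace ℝ (Fin n)) x
  obtain ⟨X, hX⟩ := exists_isCoordGerm (n := n) hx
  refine chartDeriv_injective hx (WithLp.ofLp_injective 2 (dotProduct_eq _ _ fun a => ?_))
  have h1 := h (∑ j, a j • X j)
  rw [mfderiv_eq_dotProduct _ hx, mfderiv_eq_dotProduct _ hx, partials_sum_smul hx hX] at h1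
  rw [dotProduct_comm, h1, dotProduct_comm]

/-- The carré du champ of a metric differentiates along the gradient. -/
theorem IsMetricOf.eq_mfderiv_grad {g : SmoothMetric n M} (hg : IsMetricOf Γ g)
    (f h : SmoothFn n M) (x : M) :
    Γ f h x = mfderiv (𝓡 n) 𝓘(ℝ, ℝ) h x (grad g f x) := by
  rw [hg f h x, g.symm, inner_grad]

theorem IsCometric.exists_isMetricOf [T2Space M] (hΓ : IsCometric Γ) :
    ∃ g : SmoothMetric n M, IsMetricOf Γ g := by
  obtain ⟨g, hg⟩ := hΓ.exists_metric
  refine ⟨g, fun f h x => ?_⟩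
  obtain ⟨v, hv⟩ := hΓ.exists_gradient f x
  have : v = grad g f x := eq_of_inner_eq g fun w => by rw [hg x v f hv, inner_grad]
  rw [← this, g.symm, inner_grad, hv]

theorem IsCometric.metric_unique [T2Space M] (hΓ : IsCometric Γ) {g g' : SmoothMetric n M}
    (hg : IsMetricOf Γ g) (hg' : IsMetricOf Γ g') : g' = g := by
  refine metric_ext fun x v w => ?_
  obtain ⟨f, hf⟩ := hΓ.exists_potential x v
  have h1 : v = grad g f x := eq_of_mfderiv_eq fun h => by rw [← hf, hg.eq_mfderiv_grad]
  have h2 : v = grad g' f x := eq_of_mfderiv_eq fun h => by rw [← hf, hg'.eq_mfderiv_grad]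
  conv_lhs => rw [h2, inner_grad]
  rw [h1, inner_grad]

theorem inner_sum_coordVec (g : SmoothMetric n M)
    (e : OpenPartialHomeomorph M (EuclideanSpace ℝ (Fin n)))
    (y : EuclideanSpace ℝ (Fin n)) (a b : Fin n → ℝ) :
    g.inner (e.symm y) (∑ i, a i • coordVec e y i) (∑ i, b i • coordVec e y i) =
      a ⬝ᵥ (metricMatrix g e y *ᵥ b) := by
  simp only [map_sum, map_smul, _root_.sum_apply, _root_.smul_apply, smul_eq_mul, dotProduct,
    Matrix.mulVec, Finset.mul_sum, metricMatrix, Matrix.of_apply]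
  rw [Finset.sum_comm]
  exact Finset.sum_congr rfl fun i _ => Finset.sum_congr rfl fun j _ => by ring

theorem metricMatrix_posDef (g : SmoothMetric n M) {c : M} {y : EuclideanSpace ℝ (Fin n)}
    (hy : y ∈ (chart[n] c).target) : (metricMatrix g (chart[n] c) y).PosDef := by
  refine Matrix.PosDef.of_dotProduct_mulVec_pos ?_ fun a ha => ?_
  · ext i j
    simp [metricMatrix, g.symm _ (coordVec _ _ j)]
  rw [star_trivial, ← inner_sum_coordVec]
  refine g.pos _ _ fun h0 => ha ?_
  have := chartDeriv_sum_coordVec hy a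
  rw [h0, map_zero] at this
  exact (congrArg WithLp.ofLp this).symm

theorem metricMatrix_isUnit_det (g : SmoothMetric n M) {c : M} {y : EuclideanSpace ℝ (Fin n)}
    (hy : y ∈ (chart[n] c).target) : IsUnit (metricMatrix g (chart[n] c) y).det :=
  isUnit_iff_ne_zero.2 (metricMatrix_posDef g hy).det_pos.ne'

/-- The carré du champ in coordinates: `Γ(f, h) = ∑ g^{ij} ∂_i f ∂_j h`. -/
theorem IsMetricOf.eq_dotProduct {g : SmoothMetric n M} (hg : IsMetricOf Γ g) {c : M}
    {y : EuclideanSpace ℝ (Fin n)} (hy : y ∈ (chart[n] c).target) (f h : SmoothFn n M) :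
    Γ f h ((chart[n] c).symm y) =
      (fun i => partialD i (f ∘ (chart[n] c).symm) y) ⬝ᵥ ((metricMatrix g (chart[n] c) y)⁻¹ *ᵥ
        fun j => partialD j (h ∘ (chart[n] c).symm) y) := by
  have hsum : ∀ (k : SmoothFn n M) (b : Fin n → ℝ), mfderiv (𝓡 n) 𝓘(ℝ, ℝ) k ((chart[n] c).symm y)
      (∑ i, b i • coordVec (chart[n] c) y i) =
        (fun i => partialD i (k ∘ (chart[n] c).symm) y) ⬝ᵥ b := by
    intro k b
    simp only [map_sum, map_smul, mfderiv_coordVec hy (k.mdifferentiableAt _), dotProduct]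
    exact Finset.sum_congr rfl fun i _ => mul_comm (b i) _
  obtain ⟨a, ha⟩ := eq_sum_coordVec hy (grad g f ((chart[n] c).symm y))
  have h1 : a ᵥ* metricMatrix g (chart[n] c) y = fun i => partialD i (f ∘ (chart[n] c).symm) y := by
    refine dotProduct_eq _ _ fun b => ?_
    rw [← Matrix.dotProduct_mulVec, ← inner_sum_coordVec, ← ha, inner_grad, hsum]
  rw [hg.eq_mfderiv_grad, ha, hsum, ← h1, Matrix.dotProduct_mulVec, Matrix.vecMul_vecMul,
    Matrix.mul_nonsing_inv _ (metricMatrix_isUnit_det g hy), Matrix.vecMul_one, dotProduct_comm]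

end Metric

/-! ### The volume density -/

section VolumeDensity

open Matrix

variable {n : ℕ} {M : Type*} [TopologicalSpace M] [ChartedSpace (EuclideanSpace ℝ (Fin n)) M]
  [IsManifold (𝓡 n) ∞ M] {Γ : SmoothFn n M →ₗ[ℝ] SmoothFn n M →ₗ[ℝ] SmoothFn n M}
  {g : SmoothMetric n M}

/-- The inverse of the metric matrix consists of the `Γ` of pairs of coordinates. -/
theorem IsMetricOf.metricMatrix_inv (hg : IsMetricOf Γ g) {c : M} {y : EuclideanSpace ℝ (Fin n)}
    (hy : y ∈ (chart[n] c).target) {X : Fin n → SmoothFn n M}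
    (hX : IsCoordGerm c ((chart[n] c).symm y) X) :
    (metricMatrix g (chart[n] c) y)⁻¹ = carreMatrix Γ X ((chart[n] c).symm y) := by
  have hp : ∀ j, (fun i => partialD i (X j ∘ (chart[n] c).symm) y) = Pi.single j 1 := by
    intro j
    funext i
    have := partialD_of_eventuallyEq_coord ((chart[n] c).map_target hy) (hX j) i
    rw [(chart[n] c).right_inv hy] at this
    rw [this, Pi.single_apply]
  ext i j
  rw [carreMatrix, Matrix.of_apply, hg.eq_dotProduct hy, hp, hp]
  simp

theorem IsMetricOf.contDiffOn_metricMatrix_inv [T2Space M] (hg : IsMetricOf Γ g) (c : M)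
    (i j : Fin n) :
    ContDiffOn ℝ ∞ (fun y => (metricMatrix g (chart[n] c) y)⁻¹ i j) (chart[n] c).target := by
  intro y hy
  obtain ⟨X, hX⟩ := exists_isCoordGerm (n := n) ((chart[n] c).map_target hy)
  have h1 : ContDiffAt ℝ ∞ (Γ (X i) (X j) ∘ (chart[n] c).symm) y :=
    (contDiffOn_comp_chart_symm (Γ (X i) (X j)).contMDiff.contMDiffOn).contDiffAt
      ((chart[n] c).open_target.mem_nhds hy)
  refine (h1.congr_of_eventuallyEq ?_).contDiffWithinAt
  filter_upwards [(chart[n] c).open_target.mem_nhds hy,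
    ((chart[n] c).continuousAt_symm hy).eventually hX.eventually] with z hz hzX
  rw [hg.metricMatrix_inv hz hzX]
  rfl

theorem volDensity_eq (g : SmoothMetric n M)
    (e : OpenPartialHomeomorph M (EuclideanSpace ℝ (Fin n)))
    (y : EuclideanSpace ℝ (Fin n)) :
    volDensity g e y = (√((metricMatrix g e y)⁻¹).det)⁻¹ := by
  rw [volDensity, Matrix.det_nonsing_inv, Ring.inverse_eq_inv', Real.sqrt_inv, inv_inv]

theorem metricMatrix_inv_det_pos (g : SmoothMetric n M) {c : M} {y : EuclideanSpace ℝ (Fin n)}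
    (hy : y ∈ (chart[n] c).target) : 0 < ((metricMatrix g (chart[n] c) y)⁻¹).det :=
  (metricMatrix_posDef g hy).inv.det_pos

theorem volDensity_pos (g : SmoothMetric n M) {c : M} {y : EuclideanSpace ℝ (Fin n)}
    (hy : y ∈ (chart[n] c).target) : 0 < volDensity g (chart[n] c) y :=
  Real.sqrt_pos.2 (metricMatrix_posDef g hy).det_pos

/-- Smoothness is read off the inverse matrix, whose entries are functions `Γ(x_i, x_j)`. -/
theorem IsMetricOf.contDiffOn_volDensity [T2Space M] (hg : IsMetricOf Γ g) (c : M) :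
    ContDiffOn ℝ ∞ (volDensity g (chart[n] c)) (chart[n] c).target := by
  intro y hy
  have h1 : ContDiffAt ℝ ∞ (fun y => ((metricMatrix g (chart[n] c) y)⁻¹).det) y :=
    contDiffAt_det fun k l => (hg.contDiffOn_metricMatrix_inv c k l).contDiffAt
      ((chart[n] c).open_target.mem_nhds hy)
  have h0 := metricMatrix_inv_det_pos g hy
  have h2 := (h1.sqrt h0.ne').inv (Real.sqrt_pos.2 h0).ne'
  rw [show volDensity g (chart[n] c) = _ from funext (volDensity_eq g (chart[n] c))]
  exact h2.contDiffWithinAt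

/-- The Jacobian determinant at `y` of the change of coordinates from the chart at `c` to the chart
at `d`. -/
def chartJac (n : ℕ) {M : Type*} [TopologicalSpace M] [ChartedSpace (EuclideanSpace ℝ (Fin n)) M]
    (c d : M) (y : EuclideanSpace ℝ (Fin n)) : ℝ :=
  (fderiv ℝ (chart[n] d ∘ (chart[n] c).symm) y).det

theorem contDiffOn_chart_comp_symm (c d : M) :
    ContDiffOn ℝ ∞ (chart[n] d ∘ (chart[n] c).symm) ((chart[n] c).symm ≫ₕ chart[n] d).source := by
  rw [← contMDiffOn_iff_contDiffOn]
  exact (contMDiffOn_chart (I := 𝓡 n) (x := d)).comp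
    ((contMDiffOn_chart_symm_top c).mono inter_subset_left) fun _ hy => hy.2

theorem differentiableAt_chart_comp_symm {c d : M} {y : EuclideanSpace ℝ (Fin n)}
    (hy : y ∈ (chart[n] c).target) (hyd : (chart[n] c).symm y ∈ (chart[n] d).source) :
    DifferentiableAt ℝ (chart[n] d ∘ (chart[n] c).symm) y :=
  ((contDiffOn_chart_comp_symm c d).contDiffAt
    (((chart[n] c).symm ≫ₕ chart[n] d).open_source.mem_nhds ⟨hy, hyd⟩)).differentiableAt (by simp)

/-- The volume density transforms by the Jacobian determinant. -/
theorem IsMetricOf.volDensity_transition [T2Space M] (hg : IsMetricOf Γ g) {c d : M}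
    {y : EuclideanSpace ℝ (Fin n)} (hy : y ∈ (chart[n] c).target)
    (hyd : (chart[n] c).symm y ∈ (chart[n] d).source) :
    volDensity g (chart[n] c) y =
      |chartJac n c d y| * volDensity g (chart[n] d) (chart[n] d ((chart[n] c).symm y)) := by
  obtain ⟨X, hX⟩ := exists_isCoordGerm (n := n) hyd
  set y' := chart[n] d ((chart[n] c).symm y) with hy'
  have hsymm : (chart[n] d).symm y' = (chart[n] c).symm y := (chart[n] d).left_inv hyd
  have hy't : y' ∈ (chart[n] d).target := (chart[n] d).map_source hyd
  have h1 := hg.metricMatrix_inv hy't (hsymm.symm ▸ hX)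
  rw [hsymm] at h1
  let b := (EuclideanSpace.basisFun (Fin n) ℝ).toBasis
  let D := fderiv ℝ (chart[n] d ∘ (chart[n] c).symm) y
  let J := LinearMap.toMatrix b b D.toLinearMap
  have hdiff := differentiableAt_chart_comp_symm hy hyd
  have hJ : ∀ k, (fun i => partialD i (X k ∘ (chart[n] c).symm) y) = J k := by
    intro k
    funext i
    have h2 : X k ∘ (chart[n] c).symm =ᶠ[𝓝 y]
        EuclideanSpace.proj (𝕜 := ℝ) k ∘ (chart[n] d ∘ (chart[n] c).symm) :=
      ((chart[n] c).continuousAt_symm hy).eventually (hX k)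
    rw [partialD, h2.fderiv_eq,
      fderiv_comp y (EuclideanSpace.proj (𝕜 := ℝ) k).differentiableAt hdiff,
      ContinuousLinearMap.fderiv]
    simp [J, b, D, LinearMap.toMatrix_apply, stdVec]
  have h3 : (metricMatrix g (chart[n] d) y')⁻¹ =
      J * (metricMatrix g (chart[n] c) y)⁻¹ * Jᵀ := by
    rw [h1]
    ext k l
    rw [carreMatrix, Matrix.of_apply, hg.eq_dotProduct hy, hJ, hJ, Matrix.mul_assoc]
    rfl
  have hdet : J.det = chartJac n c d y := LinearMap.det_toMatrix b _
  have h4 : ((metricMatrix g (chart[n] d) y')⁻¹).det =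
      chartJac n c d y ^ 2 * ((metricMatrix g (chart[n] c) y)⁻¹).det := by
    rw [h3, Matrix.det_mul, Matrix.det_mul, Matrix.det_transpose, hdet]
    ring
  have hne : |chartJac n c d y| ≠ 0 := by
    intro h0
    have := metricMatrix_inv_det_pos g hy't
    rw [h4, abs_eq_zero.1 h0] at this
    simp at this
  rw [volDensity_eq, volDensity_eq, h4, Real.sqrt_mul (sq_nonneg _), Real.sqrt_sq_eq_abs,
    mul_inv, mul_inv_cancel_left₀ hne]

theorem eqOn_of_setLIntegral_eq {f h : EuclideanSpace ℝ (Fin n) → ℝ}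
    {W : Set (EuclideanSpace ℝ (Fin n))} (hW : IsOpen W) (hf : ContinuousOn f W)
    (hh : ContinuousOn h W) (hf0 : ∀ y ∈ W, 0 ≤ f y) (hh0 : ∀ y ∈ W, 0 ≤ h y)
    (heq : ∀ B ⊆ W, IsOpen B →
      ∫⁻ y in B, ENNReal.ofReal (f y) = ∫⁻ y in B, ENNReal.ofReal (h y)) :
    EqOn f h W := by
  -- where one function is strictly smaller, so is its integral over a small ball
  have key : ∀ f h : EuclideanSpace ℝ (Fin n) → ℝ, ContinuousOn f W → ContinuousOn h W →
      (∀ y ∈ W, 0 ≤ f y) → (∀ B ⊆ W, IsOpen B →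
      ∫⁻ y in B, ENNReal.ofReal (f y) = ∫⁻ y in B, ENNReal.ofReal (h y)) →
      ∀ y ∈ W, h y ≤ f y := by
    intro f h hf hh hf0 heq y hy
    by_contra! hlt
    obtain ⟨a, ha1, ha2⟩ := exists_between hlt
    obtain ⟨b, hb1, hb2⟩ := exists_between ha2
    have h1 := (hf.continuousAt (hW.mem_nhds hy)).eventually (gt_mem_nhds ha1)
    have h2 := (hh.continuousAt (hW.mem_nhds hy)).eventually (lt_mem_nhds hb2)
    obtain ⟨r, hr, hB⟩ := Metric.eventually_nhds_iff_ball.1 (h1.and (h2.and (hW.mem_nhds hy)))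
    have hv0 : volume (Metric.ball y r) ≠ 0 := (Metric.measure_ball_pos _ _ hr).ne'
    have hvt : volume (Metric.ball y r) ≠ ⊤ := measure_ball_lt_top.ne
    have h3 : ∫⁻ z in Metric.ball y r, ENNReal.ofReal (f z) ≤
        ENNReal.ofReal a * volume (Metric.ball y r) := by
      rw [← setLIntegral_const]
      exact setLIntegral_mono measurable_const fun z hz =>
        ENNReal.ofReal_le_ofReal (hB z hz).1.le
    have h4 : ENNReal.ofReal b * volume (Metric.ball y r) ≤
        ∫⁻ z in Metric.ball y r, ENNReal.ofReal (h z) := by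
      rw [← setLIntegral_const]
      exact setLIntegral_mono' measurableSet_ball fun z hz =>
        ENNReal.ofReal_le_ofReal (hB z hz).2.1.le
    rw [heq _ (fun z hz => (hB z hz).2.2) Metric.isOpen_ball] at h3
    have h5 := (ENNReal.mul_le_mul_iff_left hv0 hvt).1 (h4.trans h3)
    have ha0 : 0 ≤ a := (hf0 y hy).trans ha1.le
    exact absurd ((ENNReal.ofReal_le_ofReal_iff ha0).1 h5) (not_le.2 hb1)
  exact fun y hy => le_antisymm
    (key h f hh hf hh0 (fun B hB hBo => (heq B hB hBo).symm) y hy) (key f h hf hh hf0 heq y hy)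

end VolumeDensity

/-! ### Densities of measures -/

section ChartMeasure

variable {n : ℕ} {M : Type*} [TopologicalSpace M] [ChartedSpace (EuclideanSpace ℝ (Fin n)) M]

theorem withDensity_map_eq {α β : Type*} [MeasurableSpace α] [MeasurableSpace β] {m : Measure α}
    {φ : α → β} (hφ : AEMeasurable φ m) {w : β → ENNReal} (hw : Measurable w) :
    (m.map φ).withDensity w = (m.withDensity (w ∘ φ)).map φ := by
  ext S hS
  rw [withDensity_apply _ hS, Measure.map_apply_of_aemeasurable
    (hφ.mono_ac (withDensity_absolutelyContinuous _ _)) hS,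
    Measure.restrict_map_of_aemeasurable hφ hS,
    lintegral_map' hw.aemeasurable hφ.restrict,
    withDensity_apply₀ _ (hφ.nullMeasurableSet_preimage hS)]
  rfl

theorem iUnion_coverChart_source [SecondCountableTopology M] [Nonempty M] :
    ⋃ k, (coverChart n M k).source = univ :=
  (exists_chart_cover n M).choose_spec

variable [MeasurableSpace M] [BorelSpace M]

theorem aemeasurable_chart_symm (c : M) (w : EuclideanSpace ℝ (Fin n) → ENNReal) :
    AEMeasurable (chart[n] c).symm ((volume.restrict (chart[n] c).target).withDensity w) :=
  ((chart[n] c).continuousOn_symm.aemeasurable (chart[n] c).open_target.measurableSet).mono_ac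
    (withDensity_absolutelyContinuous _ _)

theorem restrict_eq_map_of_density {ν : Measure M} {c : M} {r : EuclideanSpace ℝ (Fin n) → ℝ}
    (hr : ∀ A : Set M, MeasurableSet A → A ⊆ (chart[n] c).source →
      ν A = ∫⁻ y in chart[n] c '' A, ENNReal.ofReal (r y)) :
    ν.restrict (chart[n] c).source = Measure.map (chart[n] c).symm
      ((volume.restrict (chart[n] c).target).withDensity fun y => ENNReal.ofReal (r y)) := by
  ext S hS
  rw [Measure.restrict_apply hS, Measure.map_apply_of_aemeasurable (aemeasurable_chart_symm c _) hS,
    withDensity_apply', Measure.restrict_restrict' (chart[n] c).open_target.measurableSet,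
    hr _ (hS.inter (chart[n] c).open_source.measurableSet) inter_subset_right, inter_comm S,
    OpenPartialHomeomorph.image_source_inter_eq', inter_comm]

end ChartMeasure

section MeasureDensity

variable {n : ℕ} {M : Type*} [TopologicalSpace M] [ChartedSpace (EuclideanSpace ℝ (Fin n)) M]
  [IsManifold (𝓡 n) ∞ M] {Γ : SmoothFn n M →ₗ[ℝ] SmoothFn n M →ₗ[ℝ] SmoothFn n M}
  {g : SmoothMetric n M} [MeasurableSpace M] [BorelSpace M]

/-- The density `ρ √(det (g_ij))` of the measure `ρ dvol_g` with respect to `dy`, in the preferred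
chart at `c`. -/
def chartWeight (g : SmoothMetric n M) (ρ : M → ℝ) (c : M) (y : EuclideanSpace ℝ (Fin n)) : ℝ :=
  ρ ((chart[n] c).symm y) * volDensity g (chart[n] c) y

/-- `ν` has density `ρ` with respect to the Riemannian volume of `g`, read in each preferred chart:
there `ν = ρ √(det (g_ij)) dy`. -/
def IsChartDensity (g : SmoothMetric n M) (ν : Measure M) (ρ : M → ℝ) : Prop :=
  ∀ c : M, ν.restrict (chart[n] c).source = Measure.map (chart[n] c).symm
    ((volume.restrict (chart[n] c).target).withDensity
      fun y => ENNReal.ofReal (chartWeight g ρ c y))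

/-- By the change of variables formula, the densities of a measure in two charts differ by the
Jacobian determinant of the transition map; continuity turns equality of integrals into pointwise
equality. -/
theorem chart_density_transition {ν : Measure M} {c d : M} {r s : EuclideanSpace ℝ (Fin n) → ℝ}
    (hrc : ContinuousOn r (chart[n] c).target) (hsc : ContinuousOn s (chart[n] d).target)
    (hr0 : ∀ y ∈ (chart[n] c).target, 0 < r y) (hs0 : ∀ y ∈ (chart[n] d).target, 0 < s y)
    (hr : ∀ A : Set M, MeasurableSet A → A ⊆ (chart[n] c).source →
      ν A = ∫⁻ y in chart[n] c '' A, ENNReal.ofReal (r y))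
    (hs : ∀ A : Set M, MeasurableSet A → A ⊆ (chart[n] d).source →
      ν A = ∫⁻ y in chart[n] d '' A, ENNReal.ofReal (s y))
    {y : EuclideanSpace ℝ (Fin n)} (hy : y ∈ (chart[n] c).target)
    (hyd : (chart[n] c).symm y ∈ (chart[n] d).source) :
    r y = |chartJac n c d y| * s (chart[n] d ((chart[n] c).symm y)) := by
  set τ := (chart[n] c).symm ≫ₕ chart[n] d
  have hτ : ⇑τ = chart[n] d ∘ (chart[n] c).symm := rfl
  have hsub : τ.source ⊆ (chart[n] c).target := inter_subset_left
  have hsub' : ∀ z ∈ τ.source, (chart[n] c).symm z ∈ (chart[n] d).source := fun z hz => hz.2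
  refine eqOn_of_setLIntegral_eq
    (h := fun y => |chartJac n c d y| * s (chart[n] d ((chart[n] c).symm y))) τ.open_source
    (hrc.mono hsub) ?_ (fun z hz => (hr0 z (hsub hz)).le)
    (fun z hz => mul_nonneg (abs_nonneg _) (hs0 _ ((chart[n] d).map_source (hsub' z hz))).le) ?_
    ⟨hy, hyd⟩
  · refine ContinuousOn.mul ?_ (hsc.comp τ.continuousOn fun z hz =>
      (chart[n] d).map_source (hsub' z hz))
    have h1 : ContinuousOn (fderiv ℝ (chart[n] d ∘ (chart[n] c).symm)) τ.source :=
      ((contDiffOn_chart_comp_symm c d).continuousOn_fderiv_of_isOpen τ.open_source (by simp))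
    exact (ContinuousLinearMap.continuous_det.comp_continuousOn h1).abs
  · intro B hB hBo
    have hBc : B ⊆ (chart[n] c).target := hB.trans hsub
    set A := (chart[n] c).symm '' B
    have hAo : IsOpen A := (chart[n] c).symm.isOpen_image_of_subset_source hBo hBc
    have hAc : A ⊆ (chart[n] c).source := by
      rintro _ ⟨z, hz, rfl⟩
      exact (chart[n] c).map_target (hBc hz)
    have hAd : A ⊆ (chart[n] d).source := by
      rintro _ ⟨z, hz, rfl⟩
      exact hsub' z (hB hz)
    have hcA : chart[n] c '' A = B := by
      rw [image_image]
      exact (image_congr fun z hz => (chart[n] c).right_inv (hBc hz)).trans (image_id' B)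
    have hdA : chart[n] d '' A = (chart[n] d ∘ (chart[n] c).symm) '' B := image_image _ _ _
    have h1 := hr A hAo.measurableSet hAc
    rw [hs A hAo.measurableSet hAd, hcA, hdA,
      lintegral_image_eq_lintegral_abs_det_fderiv_mul volume hBo.measurableSet
        (f' := fun z => fderiv ℝ (chart[n] d ∘ (chart[n] c).symm) z)
        (fun z hz => (differentiableAt_chart_comp_symm (hBc hz)
          (hsub' z (hB hz))).hasFDerivAt.hasFDerivWithinAt)
        (τ.injOn.mono hB)] at h1
    rw [← h1]
    refine lintegral_congr fun z => ?_
    rw [ENNReal.ofReal_mul (abs_nonneg _)]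
    rfl

/-- The chart densities of a smooth positive measure and of the Riemannian volume transform in the
same way, so that their quotient is a function on `M`. -/
theorem IsMetricOf.exists_chartDensity [T2Space M] (hg : IsMetricOf Γ g) {ν : Measure M}
    (hν : IsSmoothPositiveMeasure n ν) :
    ∃ ρ : M → ℝ, ContMDiff (𝓡 n) 𝓘(ℝ, ℝ) ∞ ρ ∧ (∀ x, 0 < ρ x) ∧ IsChartDensity g ν ρ := by
  choose r hrs hr0 hr using hν
  let q : M → EuclideanSpace ℝ (Fin n) → ℝ := fun c y => r c y / volDensity g (chart[n] c) y
  have hq : ∀ c d x, x ∈ (chart[n] c).source → x ∈ (chart[n] d).source →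
      q c (chart[n] c x) = q d (chart[n] d x) := by
    intro c d x hc hd
    have hy := (chart[n] c).map_source hc
    have hinv := (chart[n] c).left_inv hc
    have hd' : (chart[n] c).symm (chart[n] c x) ∈ (chart[n] d).source := by rwa [hinv]
    have h1 := chart_density_transition (hrs c).continuousOn (hrs d).continuousOn (hr0 c) (hr0 d)
      (hr c) (hr d) hy hd'
    have h2 := hg.volDensity_transition hy hd'
    rw [hinv] at h1 h2
    have h3 := volDensity_pos g hy
    have hJ : |chartJac n c d (chart[n] c x)| ≠ 0 := by
      intro h0
      rw [h2, h0, zero_mul] at h3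
      exact lt_irrefl _ h3
    simp only [q]
    rw [h1, h2, mul_div_mul_left _ _ hJ]
  have hx := fun x : M => mem_chart_source (EuclideanSpace ℝ (Fin n)) x
  refine ⟨fun x => q x (chart[n] x x), fun x => ?_, fun x => ?_, fun c => ?_⟩
  · have h1 : ContDiffOn ℝ ∞ (q x) (chart[n] x).target :=
      (hrs x).div (hg.contDiffOn_volDensity x) fun y hy => (volDensity_pos g hy).ne'
    refine ((contMDiffOn_comp_chart h1).contMDiffAt
      ((chart[n] x).open_source.mem_nhds (hx x))).congr_of_eventuallyEq ?_
    filter_upwards [(chart[n] x).open_source.mem_nhds (hx x)] with z hz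
    exact hq z x z (hx z) hz
  · exact div_pos (hr0 x _ ((chart[n] x).map_source (hx x)))
      (volDensity_pos g ((chart[n] x).map_source (hx x)))
  · rw [restrict_eq_map_of_density (hr c)]
    congr 1
    refine withDensity_congr_ae ?_
    filter_upwards [ae_restrict_mem (chart[n] c).open_target.measurableSet] with y hy
    have h1 := hq ((chart[n] c).symm y) c ((chart[n] c).symm y) (hx _) ((chart[n] c).map_target hy)
    rw [(chart[n] c).right_inv hy] at h1
    rw [chartWeight, h1, div_mul_cancel₀ _ (volDensity_pos g hy).ne']

theorem IsChartDensity.withDensity_chart [T2Space M] (hg : IsMetricOf Γ g) {ν : Measure M}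
    {ρ : M → ℝ} (hρ : ContMDiff (𝓡 n) 𝓘(ℝ, ℝ) ∞ ρ) (hpos : ∀ x, 0 < ρ x)
    (h : IsChartDensity g ν ρ) (c : M) :
    (Measure.map (chart[n] c).symm ((volume.restrict (chart[n] c).target).withDensity
      (fun y => ENNReal.ofReal (volDensity g (chart[n] c) y)))).withDensity
        (fun x => ENNReal.ofReal (ρ x)) = ν.restrict (chart[n] c).source := by
  have hm : Measurable fun x => ENNReal.ofReal (ρ x) := hρ.continuous.measurable.ennreal_ofReal
  rw [withDensity_map_eq (aemeasurable_chart_symm _ _) hm, h c, ← withDensity_mul₀]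
  · refine congrArg _ (congrArg _ (funext fun y => ?_))
    rw [Pi.mul_apply, chartWeight, ENNReal.ofReal_mul (hpos _).le, mul_comm]
    rfl
  · exact ((hg.contDiffOn_volDensity _).continuousOn.aemeasurable
      (chart[n] c).open_target.measurableSet).ennreal_ofReal
  · exact hm.comp_aemeasurable ((chart[n] c).continuousOn_symm.aemeasurable
      (chart[n] c).open_target.measurableSet)

variable [SecondCountableTopology M] [Nonempty M]

theorem IsChartDensity.eq_withDensity [T2Space M] (hg : IsMetricOf Γ g) {ν : Measure M} {ρ : M → ℝ}
    (hρ : ContMDiff (𝓡 n) 𝓘(ℝ, ℝ) ∞ ρ) (hpos : ∀ x, 0 < ρ x) (h : IsChartDensity g ν ρ) :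
    ν = (riemannianVolume g).withDensity fun x => ENNReal.ofReal (ρ x) := by
  have hD : ∀ k, MeasurableSet (disjointed (fun j => (coverChart n M j).source) k) :=
    fun k => MeasurableSet.disjointed (fun j => (coverChart n M j).open_source.measurableSet) k
  have hk : ∀ k, ((Measure.map (coverChart n M k).symm
      ((volume.restrict (coverChart n M k).target).withDensity
        (fun y => ENNReal.ofReal (volDensity g (coverChart n M k) y)))).restrict
      (disjointed (fun j => (coverChart n M j).source) k)).withDensity
        (fun x => ENNReal.ofReal (ρ x)) =
      ν.restrict (disjointed (fun j => (coverChart n M j).source) k) := by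
    intro k
    obtain ⟨c, hc⟩ : ∃ c, coverChart n M k = chart[n] c := ⟨_, rfl⟩
    have hsub : disjointed (fun j => (coverChart n M j).source) k ⊆ (coverChart n M k).source :=
      disjointed_subset _ _
    rw [hc] at hsub
    rw [← restrict_withDensity (hD k), hc, h.withDensity_chart hg hρ hpos,
      Measure.restrict_restrict (hD k), inter_eq_left.2 hsub]
  rw [riemannianVolume, withDensity_sum]
  simp_rw [hk]
  rw [← Measure.restrict_iUnion (disjoint_disjointed _) hD, iUnion_disjointed,
    iUnion_coverChart_source, Measure.restrict_univ]

end MeasureDensity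

/-! ### Integration by parts -/

section Euclidean

variable {n : ℕ}

theorem contDiffOn_partialD {W : Set (EuclideanSpace ℝ (Fin n))} (hW : IsOpen W)
    {F : EuclideanSpace ℝ (Fin n) → ℝ} (hF : ContDiffOn ℝ ∞ F W) (i : Fin n) :
    ContDiffOn ℝ ∞ (partialD i F) W :=
  (hF.fderiv_of_isOpen hW (by simp)).clm_apply contDiffOn_const

theorem partialD_mul {F G : EuclideanSpace ℝ (Fin n) → ℝ} {y : EuclideanSpace ℝ (Fin n)}
    (hF : DifferentiableAt ℝ F y) (hG : DifferentiableAt ℝ G y) (i : Fin n) :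
    partialD i (fun z => F z * G z) y = partialD i F y * G y + F y * partialD i G y := by
  rw [partialD, fderiv_fun_mul hF hG]
  simp [partialD]
  ring

theorem integral_partialD_eq_zero {H : EuclideanSpace ℝ (Fin n) → ℝ} (hH : ContDiff ℝ ∞ H)
    (hc : HasCompactSupport H) (i : Fin n) :
    Integrable (partialD i H) ∧ ∫ y, partialD i H y = 0 := by
  have hcont : Continuous (partialD i H) :=
    (hH.continuous_fderiv (by simp)).clm_apply continuous_const
  have hint : Integrable (partialD i H) := hcont.integrable_of_hasCompactSupport
    (hc.fderiv_apply (𝕜 := ℝ) (stdVec i))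
  refine ⟨hint, ?_⟩
  have := integral_mul_fderiv_eq_neg_fderiv_mul_of_integrable (μ := volume)
    (f := H) (g := fun _ => (1 : ℝ)) (v := stdVec i) (by simp only [mul_one]; exact hint) (by simp)
    (by simpa using hH.continuous.integrable_of_hasCompactSupport hc)
    (fun x _ => hH.differentiable (by simp) x) (by simp)
  simpa [partialD] using this

/-- Integration by parts on an open set, where one factor vanishes off a compact subset. -/
theorem setIntegral_partialD_mul {W K : Set (EuclideanSpace ℝ (Fin n))} (hW : IsOpen W)
    (hK : IsCompact K) (hKW : K ⊆ W) {F ψ : EuclideanSpace ℝ (Fin n) → ℝ}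
    (hF : ContDiffOn ℝ ∞ F W) (hψ : ContDiffOn ℝ ∞ ψ W) (hψK : ∀ y ∈ W, y ∉ K → ψ y = 0)
    (i : Fin n) :
    IntegrableOn (fun y => partialD i F y * ψ y + F y * partialD i ψ y) W ∧
      ∫ y in W, (partialD i F y * ψ y + F y * partialD i ψ y) = 0 := by
  let H := W.indicator fun y => F y * ψ y
  have hin : ∀ y ∈ W, H =ᶠ[𝓝 y] fun y => F y * ψ y := fun y hy => by
    filter_upwards [hW.mem_nhds hy] with z hz using indicator_of_mem hz _
  have h0 : ∀ y ∉ K, H y = 0 := fun y hy => by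
    by_cases hyW : y ∈ W
    · simp [H, hyW, hψK y hyW hy]
    · simp [H, hyW]
  have hout : ∀ y ∉ W, H =ᶠ[𝓝 y] fun _ => 0 := fun y hy => by
    filter_upwards [hK.isClosed.isOpen_compl.mem_nhds fun h => hy (hKW h)] with z hz using h0 z hz
  have hH : ContDiff ℝ ∞ H := contDiff_iff_contDiffAt.2 fun y => by
    by_cases hy : y ∈ W
    · exact (((hF.mul hψ).contDiffAt (hW.mem_nhds hy))).congr_of_eventuallyEq (hin y hy)
    · exact contDiffAt_const.congr_of_eventuallyEq (hout y hy)
  have hc : HasCompactSupport H := HasCompactSupport.intro hK h0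
  have hd : partialD i H = W.indicator fun y => partialD i F y * ψ y + F y * partialD i ψ y := by
    funext y
    by_cases hy : y ∈ W
    · rw [indicator_of_mem hy, ← partialD_mul]
      · rw [partialD, (hin y hy).fderiv_eq]
        rfl
      · exact (hF.contDiffAt (hW.mem_nhds hy)).differentiableAt (by simp)
      · exact (hψ.contDiffAt (hW.mem_nhds hy)).differentiableAt (by simp)
    · rw [indicator_of_notMem hy, partialD, (hout y hy).fderiv_eq]
      simp
  obtain ⟨h1, h2⟩ := integral_partialD_eq_zero hH hc i
  rw [hd] at h1 h2
  rw [integral_indicator hW.measurableSet] at h2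
  exact ⟨(integrable_indicator_iff hW.measurableSet).1 h1, h2⟩

end Euclidean

/-! ### The weighted Laplacian and Green's formula -/

section Green

open Matrix

variable {n : ℕ} {M : Type*} [TopologicalSpace M] [ChartedSpace (EuclideanSpace ℝ (Fin n)) M]
  [IsManifold (𝓡 n) ∞ M] {Γ : SmoothFn n M →ₗ[ℝ] SmoothFn n M →ₗ[ℝ] SmoothFn n M}
  {g : SmoothMetric n M}

/-- The `i`-th component `∑_j g^{ij} ∂_j f` of the gradient in the preferred chart at `c`. -/
def chartGrad (g : SmoothMetric n M) (c : M) (f : M → ℝ) (i : Fin n)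
    (y : EuclideanSpace ℝ (Fin n)) : ℝ :=
  ∑ j, (metricMatrix g (chart[n] c) y)⁻¹ i j * partialD j (f ∘ (chart[n] c).symm) y

/-- The weighted Laplacian in divergence form `w⁻¹ ∑_i ∂_i (w ∑_j g^{ij} ∂_j f)`, computed in the
preferred chart at `c`, where `w` is the density of the measure. -/
def chartLaplacian (g : SmoothMetric n M) (ρ : M → ℝ) (c : M) (f : M → ℝ)
    (y : EuclideanSpace ℝ (Fin n)) : ℝ :=
  (chartWeight g ρ c y)⁻¹ *
    ∑ i, partialD i (fun z => chartWeight g ρ c z * chartGrad g c f i z) y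

theorem chartWeight_pos {ρ : M → ℝ} (hpos : ∀ x, 0 < ρ x) {c : M} {y : EuclideanSpace ℝ (Fin n)}
    (hy : y ∈ (chart[n] c).target) : 0 < chartWeight g ρ c y :=
  mul_pos (hpos _) (volDensity_pos g hy)

theorem IsMetricOf.contDiffOn_chartWeight [T2Space M] (hg : IsMetricOf Γ g) {ρ : M → ℝ}
    (hρ : ContMDiff (𝓡 n) 𝓘(ℝ, ℝ) ∞ ρ) (c : M) :
    ContDiffOn ℝ ∞ (chartWeight g ρ c) (chart[n] c).target :=
  (contDiffOn_comp_chart_symm hρ.contMDiffOn).mul (hg.contDiffOn_volDensity c)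

theorem IsMetricOf.contDiffOn_chartGrad [T2Space M] (hg : IsMetricOf Γ g) (c : M) (f : SmoothFn n M)
    (i : Fin n) : ContDiffOn ℝ ∞ (chartGrad g c f i) (chart[n] c).target :=
  ContDiffOn.sum fun j _ => (hg.contDiffOn_metricMatrix_inv c i j).mul
    (contDiffOn_partialD (chart[n] c).open_target
      (contDiffOn_comp_chart_symm f.contMDiff.contMDiffOn) j)

theorem IsMetricOf.contDiffOn_chartLaplacian [T2Space M] (hg : IsMetricOf Γ g) {ρ : M → ℝ}
    (hρ : ContMDiff (𝓡 n) 𝓘(ℝ, ℝ) ∞ ρ) (hpos : ∀ x, 0 < ρ x) (c : M) (f : SmoothFn n M) :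
    ContDiffOn ℝ ∞ (chartLaplacian g ρ c f) (chart[n] c).target :=
  ((hg.contDiffOn_chartWeight hρ c).inv fun _ hy => (chartWeight_pos hpos hy).ne').mul
    (ContDiffOn.sum fun i _ => contDiffOn_partialD (chart[n] c).open_target
      ((hg.contDiffOn_chartWeight hρ c).mul (hg.contDiffOn_chartGrad c f i)) i)

theorem IsMetricOf.eq_sum_chartGrad (hg : IsMetricOf Γ g) {c : M} {y : EuclideanSpace ℝ (Fin n)}
    (hy : y ∈ (chart[n] c).target) (f h : SmoothFn n M) :
    Γ f h ((chart[n] c).symm y) =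
      ∑ i, chartGrad g c f i y * partialD i (h ∘ (chart[n] c).symm) y := by
  have hsymm : Γ f h ((chart[n] c).symm y) = Γ h f ((chart[n] c).symm y) := by
    rw [hg f h, hg h f, g.symm]
  rw [hsymm, hg.eq_dotProduct hy]
  exact Finset.sum_congr rfl fun i _ => mul_comm _ _

/-- The product rule turns `w⁻¹ ∂_i (w ∇^i f)` with `w = ρ √(det (g_ij))` into the Laplace--Beltrami
operator plus the drift `⟨∇ log ρ, ∇ f⟩`. -/
theorem IsMetricOf.weightedLaplacian_eq [T2Space M] (hg : IsMetricOf Γ g) {ρ : M → ℝ}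
    (hρ : ContMDiff (𝓡 n) 𝓘(ℝ, ℝ) ∞ ρ) (hpos : ∀ x, 0 < ρ x) (f : SmoothFn n M) (x : M) :
    weightedLaplacian g ρ f x = chartLaplacian g ρ x f (chart[n] x x) := by
  have hy := (chart[n] x).map_source (mem_chart_source (EuclideanSpace ℝ (Fin n)) x)
  have hinv := (chart[n] x).left_inv (mem_chart_source (EuclideanSpace ℝ (Fin n)) x)
  set y := chart[n] x x with hyx
  have hlog : ContMDiff (𝓡 n) 𝓘(ℝ, ℝ) ∞ fun x => Real.log (ρ x) := fun x =>
    (Real.contDiffAt_log.2 (hpos x).ne').contMDiffAt.comp x (hρ x)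
  have h1 : g.inner x (grad g (fun y => Real.log (ρ y)) x) (grad g f x) =
      ∑ i, chartGrad g x f i y * partialD i ((fun y => Real.log (ρ y)) ∘ (chart[n] x).symm) y := by
    rw [g.symm]
    have := hg.eq_sum_chartGrad hy f ⟨_, hlog⟩
    rw [hinv] at this
    rw [hg f ⟨_, hlog⟩] at this
    exact this
  have hdρ : DifferentiableAt ℝ (ρ ∘ (chart[n] x).symm) y :=
    ((contDiffOn_comp_chart_symm hρ.contMDiffOn).contDiffAt
      ((chart[n] x).open_target.mem_nhds hy)).differentiableAt (by simp)
  have h2 : ∀ i, partialD i ((fun y => Real.log (ρ y)) ∘ (chart[n] x).symm) y =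
      (ρ x)⁻¹ * partialD i (ρ ∘ (chart[n] x).symm) y := by
    intro i
    have h3 := fderiv.log hdρ (hpos _).ne'
    have h4 : (fun y => Real.log (ρ y)) ∘ (chart[n] x).symm =
      fun z => Real.log ((ρ ∘ (chart[n] x).symm) z) := rfl
    rw [partialD, h4, h3, Function.comp_apply, hinv]
    rfl
  have hdv : ∀ i, DifferentiableAt ℝ
      (fun z => volDensity g (chart[n] x) z * chartGrad g x f i z) y := fun i =>
    (((hg.contDiffOn_volDensity x).mul (hg.contDiffOn_chartGrad x f i)).contDiffAt
      ((chart[n] x).open_target.mem_nhds hy)).differentiableAt (by simp)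
  have h5 : ∀ i, partialD i (fun z => chartWeight g ρ x z * chartGrad g x f i z) y =
      partialD i (ρ ∘ (chart[n] x).symm) y * (volDensity g (chart[n] x) y * chartGrad g x f i y) +
        ρ x * partialD i (fun z => volDensity g (chart[n] x) z * chartGrad g x f i z) y := by
    intro i
    have h6 := partialD_mul hdρ (hdv i) i
    rw [Function.comp_apply, hinv] at h6
    rw [← h6]
    congr 1
    funext z
    exact mul_assoc _ _ _
  have hv := (volDensity_pos g hy).ne'
  have hr := (hpos x).ne'
  rw [weightedLaplacian, h1, laplaceBeltrami, chartLaplacian]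
  simp_rw [h2, h5]
  change (volDensity g (chart[n] x) y)⁻¹ * ∑ i, partialD i
    (fun z => volDensity g (chart[n] x) z * chartGrad g x f i z) y + _ = _
  rw [chartWeight, hinv, Finset.sum_add_distrib, mul_add, add_comm, Finset.mul_sum, Finset.mul_sum,
    Finset.mul_sum]
  congr 1 <;> refine Finset.sum_congr rfl fun i _ => ?_ <;> field_simp

theorem IsMetricOf.eq_zero_of_notMem_tsupport (hg : IsMetricOf Γ g) (f : SmoothFn n M)
    {φ : SmoothFn n M} {x : M} (hx : x ∉ tsupport φ) : Γ f φ x = 0 := by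
  have h0 : φ =ᶠ[𝓝 x] fun _ => 0 := notMem_tsupport_iff_eventuallyEq.1 hx
  rw [hg.eq_mfderiv_grad, h0.mfderiv_eq, mfderiv_const]
  rfl

theorem IsMetricOf.hasCompactSupport (hg : IsMetricOf Γ g) (f : SmoothFn n M)
    {φ : SmoothFn n M} (hφ : HasCompactSupport φ) : HasCompactSupport (Γ f φ) :=
  hφ.mono' fun _ hx => by_contra fun h => hx (hg.eq_zero_of_notMem_tsupport f h)

theorem IsMetricOf.continuous_chartLaplacian_mul [T2Space M] (hg : IsMetricOf Γ g) {ρ : M → ℝ}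
    (hρ : ContMDiff (𝓡 n) 𝓘(ℝ, ℝ) ∞ ρ) (hpos : ∀ x, 0 < ρ x) {c : M}
    (f : SmoothFn n M) {φ : SmoothFn n M} (hφc : tsupport φ ⊆ (chart[n] c).source) :
    Continuous fun x => chartLaplacian g ρ c f (chart[n] c x) * φ x := by
  have hcont : ContinuousOn (fun x => chartLaplacian g ρ c f (chart[n] c x) * φ x)
      (chart[n] c).source :=
    ((hg.contDiffOn_chartLaplacian hρ hpos c f).continuousOn.comp (chart[n] c).continuousOn
      fun x hx => (chart[n] c).map_source hx).mul φ.contMDiff.continuous.continuousOn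
  exact hcont.continuous_of_tsupport_subset (chart[n] c).open_source
    (tsupport_mul_subset_right.trans hφc)

variable [MeasurableSpace M] [BorelSpace M] {μ : Measure M} {ρ : M → ℝ}

theorem IsChartDensity.integral_eq (h : IsChartDensity g μ ρ) [T2Space M] (hg : IsMetricOf Γ g)
    (hρ : ContMDiff (𝓡 n) 𝓘(ℝ, ℝ) ∞ ρ) (hpos : ∀ x, 0 < ρ x) {c : M} {F : M → ℝ}
    (hF : ContinuousOn F (chart[n] c).source) (hF0 : ∀ x ∉ (chart[n] c).source, F x = 0) :
    ∫ x, F x ∂μ = ∫ y in (chart[n] c).target,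
      F ((chart[n] c).symm y) * chartWeight g ρ c y := by
  rw [← setIntegral_eq_integral_of_forall_compl_eq_zero hF0]
  have hae : AEStronglyMeasurable F (μ.restrict (chart[n] c).source) :=
    hF.aestronglyMeasurable (chart[n] c).open_source.measurableSet
  rw [h c] at hae
  rw [h c, integral_map (aemeasurable_chart_symm c _) hae,
    integral_withDensity_eq_integral_toReal_smul₀
      ((hg.contDiffOn_chartWeight hρ c).continuousOn.aemeasurable
        (chart[n] c).open_target.measurableSet).ennreal_ofReal
      (Eventually.of_forall fun _ => ENNReal.ofReal_lt_top)]
  refine setIntegral_congr_fun (chart[n] c).open_target.measurableSet fun y hy => ?_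
  have h1 := ENNReal.toReal_ofReal (chartWeight_pos (g := g) hpos hy).le
  simp only [smul_eq_mul]
  rw [h1, mul_comm]

theorem IsChartDensity.isLocallyFiniteMeasure (h : IsChartDensity g μ ρ) [T2Space M]
    (hg : IsMetricOf Γ g) (hρ : ContMDiff (𝓡 n) 𝓘(ℝ, ℝ) ∞ ρ) :
    IsLocallyFiniteMeasure μ := by
  refine ⟨fun x => ?_⟩
  have hx := mem_chart_source (EuclideanSpace ℝ (Fin n)) x
  obtain ⟨K, hK, hxK, hKt⟩ := exists_compact_subset (chart[n] x).open_target
    ((chart[n] x).map_source hx)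
  have hS : IsOpen ((chart[n] x).source ∩ chart[n] x ⁻¹' interior K) :=
    (chart[n] x).isOpen_inter_preimage isOpen_interior
  refine ⟨_, hS.mem_nhds ⟨hx, hxK⟩, ?_⟩
  have h1 : μ ((chart[n] x).source ∩ chart[n] x ⁻¹' interior K) =
      μ.restrict (chart[n] x).source ((chart[n] x).source ∩ chart[n] x ⁻¹' interior K) := by
    rw [Measure.restrict_apply hS.measurableSet, inter_eq_left.2 inter_subset_left]
  have hint : IntegrableOn (chartWeight g ρ x) K volume :=
    ((hg.contDiffOn_chartWeight hρ x).continuousOn.mono hKt).integrableOn_compact hK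
  rw [h1, h x, Measure.map_apply_of_aemeasurable (aemeasurable_chart_symm x _) hS.measurableSet,
    withDensity_apply', Measure.restrict_restrict' (chart[n] x).open_target.measurableSet]
  refine lt_of_le_of_lt (lintegral_mono_set ?_) hint.lintegral_lt_top
  rintro y ⟨hy, hyt⟩
  have := hy.2
  rw [mem_preimage, (chart[n] x).right_inv hyt] at this
  exact interior_subset this

/-- Green's formula in a chart. -/
theorem IsChartDensity.integral_chartLaplacian (h : IsChartDensity g μ ρ) [T2Space M]
    [IsLocallyFiniteMeasure μ]
    (hg : IsMetricOf Γ g) (hρ : ContMDiff (𝓡 n) 𝓘(ℝ, ℝ) ∞ ρ) (hpos : ∀ x, 0 < ρ x) {c : M}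
    (f : SmoothFn n M) {φ : SmoothFn n M} (hφ : HasCompactSupport φ)
    (hφc : tsupport φ ⊆ (chart[n] c).source) :
    ∫ x, chartLaplacian g ρ c f (chart[n] c x) * φ x ∂μ = - ∫ x, Γ f φ x ∂μ := by
  set K := chart[n] c '' tsupport φ
  have hK : IsCompact K := hφ.isCompact.image_of_continuousOn ((chart[n] c).continuousOn.mono hφc)
  have hKt : K ⊆ (chart[n] c).target := by
    rintro _ ⟨x, hx, rfl⟩
    exact (chart[n] c).map_source (hφc hx)
  have hφK : ∀ y ∈ (chart[n] c).target, y ∉ K → (φ ∘ (chart[n] c).symm) y = 0 := by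
    intro y hy hyK
    exact image_eq_zero_of_notMem_tsupport (f := φ) fun hx =>
      hyK ⟨_, hx, (chart[n] c).right_inv hy⟩
  have hcont := hg.continuous_chartLaplacian_mul hρ hpos f hφc
  have hcont' : Continuous (Γ f φ) := (Γ f φ).contMDiff.continuous
  rw [← sub_eq_zero, sub_neg_eq_add, ← integral_add
    (hcont.integrable_of_hasCompactSupport hφ.mul_left)
    (hcont'.integrable_of_hasCompactSupport (hg.hasCompactSupport f hφ)),
    h.integral_eq hg hρ hpos
      (F := fun x => chartLaplacian g ρ c f (chart[n] c x) * φ x + Γ f φ x)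
      (hcont.add hcont').continuousOn fun x hx => by
      have hx' : x ∉ tsupport φ := fun h => hx (hφc h)
      rw [image_eq_zero_of_notMem_tsupport hx', hg.eq_zero_of_notMem_tsupport f hx', mul_zero,
        add_zero]]
  have hparts := fun i => setIntegral_partialD_mul (chart[n] c).open_target hK hKt
    ((hg.contDiffOn_chartWeight hρ c).mul (hg.contDiffOn_chartGrad c f i))
    (contDiffOn_comp_chart_symm φ.contMDiff.contMDiffOn) hφK i
  rw [← Finset.sum_eq_zero fun i (_ : i ∈ Finset.univ) => (hparts i).2,
    ← integral_finsetSum _ fun i _ => (hparts i).1]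
  refine setIntegral_congr_fun (chart[n] c).open_target.measurableSet fun y hy => ?_
  have hw := (chartWeight_pos (g := g) hpos hy).ne'
  simp only [(chart[n] c).right_inv hy, hg.eq_sum_chartGrad hy, chartLaplacian,
    Finset.sum_add_distrib, Function.comp_apply]
  rw [← Finset.sum_mul, add_mul]
  congr 1
  · rw [mul_right_comm _ (φ _), mul_right_comm _ _ (chartWeight g ρ c y),
      inv_mul_cancel₀ hw, one_mul]
  · rw [Finset.sum_mul]
    exact Finset.sum_congr rfl fun i _ => by ring

/-- The divergence form of the weighted Laplacian does not depend on the chart, since Green's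
formula determines it in terms of `Γ` and `μ`. -/
theorem IsChartDensity.chartLaplacian_eq (h : IsChartDensity g μ ρ) [T2Space M]
    [SecondCountableTopology M] [IsLocallyFiniteMeasure μ] [μ.IsOpenPosMeasure]
    (hg : IsMetricOf Γ g) (hρ : ContMDiff (𝓡 n) 𝓘(ℝ, ℝ) ∞ ρ) (hpos : ∀ x, 0 < ρ x)
    (f : SmoothFn n M) {c d x : M} (hc : x ∈ (chart[n] c).source) (hd : x ∈ (chart[n] d).source) :
    chartLaplacian g ρ c f (chart[n] c x) = chartLaplacian g ρ d f (chart[n] d x) := by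
  have hcont : ∀ c : M, ContinuousOn (fun x => chartLaplacian g ρ c f (chart[n] c x))
      (chart[n] c).source := fun c =>
    (hg.contDiffOn_chartLaplacian hρ hpos c f).continuousOn.comp (chart[n] c).continuousOn
      fun x hx => (chart[n] c).map_source hx
  have hU : IsOpen ((chart[n] c).source ∩ (chart[n] d).source) :=
    (chart[n] c).open_source.inter (chart[n] d).open_source
  have h1 := (hcont c).mono (inter_subset_left (t := (chart[n] d).source))
  have h2 := (hcont d).mono (inter_subset_right (s := (chart[n] c).source))
  have : LocallyCompactSpace M := ChartedSpace.locallyCompactSpace (EuclideanSpace ℝ (Fin n)) M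
  have hae := hU.ae_eq_zero_of_integral_contMDiff_smul_eq_zero (𝓡 n) (μ := μ)
    ((h1.sub h2).locallyIntegrableOn hU.measurableSet) fun φ hφ hφs hφU => by
      let φ' : SmoothFn n M := ⟨φ, hφ⟩
      have hφc : tsupport φ' ⊆ (chart[n] c).source := hφU.trans inter_subset_left
      have hφd : tsupport φ' ⊆ (chart[n] d).source := hφU.trans inter_subset_right
      have i1 := (hg.continuous_chartLaplacian_mul hρ hpos f hφc).integrable_of_hasCompactSupport
        (μ := μ) (HasCompactSupport.mul_left (f := fun _ => _) hφs)
      have i2 := (hg.continuous_chartLaplacian_mul hρ hpos f hφd).integrable_of_hasCompactSupport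
        (μ := μ) (HasCompactSupport.mul_left (f := fun _ => _) hφs)
      have e1 := h.integral_chartLaplacian hg hρ hpos f (φ := φ') hφs hφc
      have e2 := h.integral_chartLaplacian hg hρ hpos f (φ := φ') hφs hφd
      rw [← sub_eq_zero.2 (e1.trans e2.symm), ← integral_sub i1 i2]
      refine integral_congr_ae (Eventually.of_forall fun x => ?_)
      change φ x * (_ - _) = _ * φ x - _ * φ x
      ring
  refine Measure.eqOn_open_of_ae_eq (μ := μ) ?_ hU h1 h2 ⟨hc, hd⟩
  rw [EventuallyEq, ae_restrict_iff' hU.measurableSet]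
  filter_upwards [hae] with x hx hxU using sub_eq_zero.1 (hx hxU)

theorem IsChartDensity.weightedLaplacian_eq_chart (h : IsChartDensity g μ ρ) [T2Space M]
    [SecondCountableTopology M] [IsLocallyFiniteMeasure μ] [μ.IsOpenPosMeasure]
    (hg : IsMetricOf Γ g) (hρ : ContMDiff (𝓡 n) 𝓘(ℝ, ℝ) ∞ ρ) (hpos : ∀ x, 0 < ρ x)
    (f : SmoothFn n M) {c x : M} (hc : x ∈ (chart[n] c).source) :
    weightedLaplacian g ρ f x = chartLaplacian g ρ c f (chart[n] c x) := by
  rw [hg.weightedLaplacian_eq hρ hpos,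
    h.chartLaplacian_eq hg hρ hpos f (mem_chart_source _ x) hc]

theorem IsChartDensity.continuous_weightedLaplacian (h : IsChartDensity g μ ρ) [T2Space M]
    [SecondCountableTopology M] [IsLocallyFiniteMeasure μ] [μ.IsOpenPosMeasure]
    (hg : IsMetricOf Γ g) (hρ : ContMDiff (𝓡 n) 𝓘(ℝ, ℝ) ∞ ρ) (hpos : ∀ x, 0 < ρ x)
    (f : SmoothFn n M) : Continuous (weightedLaplacian g ρ f) := by
  refine continuous_iff_continuousAt.2 fun c => ?_
  have hnhds := (chart[n] c).open_source.mem_nhds (mem_chart_source _ c)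
  have hcont : ContinuousOn (fun x => chartLaplacian g ρ c f (chart[n] c x))
      (chart[n] c).source :=
    (hg.contDiffOn_chartLaplacian hρ hpos c f).continuousOn.comp (chart[n] c).continuousOn
      fun x hx => (chart[n] c).map_source hx
  refine (hcont.continuousAt hnhds).congr ?_
  filter_upwards [hnhds] with x hx using (h.weightedLaplacian_eq_chart hg hρ hpos f hx).symm

end Green

/-! ### The generator -/

section Generator

variable {M : Type*} [MeasurableSpace M] {μ : Measure M}

theorem integral_mul_eq_inner (u v : Lp ℝ 2 μ) : ∫ x, u x * v x ∂μ = inner ℝ u v := by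
  rw [L2.inner_def]
  exact integral_congr_ae (Eventually.of_forall fun x => mul_comm (u x) (v x))

theorem integrable_mul_Lp (u v : Lp ℝ 2 μ) : Integrable (fun x => u x * v x) μ :=
  (L2.integrable_inner (𝕜 := ℝ) u v).congr (Eventually.of_forall fun x => mul_comm (v x) (u x))

theorem integral_mul_congr {u v : Lp ℝ 2 μ} {f h : M → ℝ} (hu : u =ᵐ[μ] f) (hv : v =ᵐ[μ] h) :
    ∫ x, f x * h x ∂μ = ∫ x, u x * v x ∂μ :=
  integral_congr_ae (by filter_upwards [hu, hv] with x h1 h2; rw [h1, h2])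

theorem integrable_mul_congr {u v : Lp ℝ 2 μ} {f h : M → ℝ} (hu : u =ᵐ[μ] f) (hv : v =ᵐ[μ] h) :
    Integrable (fun x => f x * h x) μ :=
  (integrable_mul_Lp u v).congr (by filter_upwards [hu, hv] with x h1 h2; rw [h1, h2])

variable {P : ℝ≥0 → Lp ℝ 2 μ →L[ℝ] Lp ℝ 2 μ}

/-- The derivative at `t = 0` of the identity `⟨P_t u, z⟩ = ⟨w, P_t v⟩`. -/
theorem HasGenerator.inner_eq {u u' v v' w z : Lp ℝ 2 μ} (hu : HasGenerator P u u')
    (hv : HasGenerator P v v') (h0 : inner ℝ u z = inner ℝ w v)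
    (h : ∀ t, inner ℝ (P t u) z = inner ℝ w (P t v)) : inner ℝ u' z = inner ℝ w v' := by
  have h1 : Tendsto (fun t : ℝ≥0 => inner ℝ ((t : ℝ)⁻¹ • (P t u - u)) z) (𝓝[>] 0)
      (𝓝 (inner ℝ u' z)) := hu.inner tendsto_const_nhds
  have h2 : Tendsto (fun t : ℝ≥0 => inner ℝ w ((t : ℝ)⁻¹ • (P t v - v))) (𝓝[>] 0)
      (𝓝 (inner ℝ w v')) := tendsto_const_nhds.inner hv
  refine tendsto_nhds_unique h1 (h2.congr fun t => ?_)
  rw [real_inner_smul_left, real_inner_smul_right, inner_sub_left, inner_sub_right, h t, h0]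

theorem HasGenerator.symm (hsymm : ∀ (t : ℝ≥0) (u v : Lp ℝ 2 μ),
      ∫ x, P t u x * v x ∂μ = ∫ x, u x * P t v x ∂μ) {u u' v v' : Lp ℝ 2 μ}
    (hu : HasGenerator P u u') (hv : HasGenerator P v v') :
    ∫ x, u' x * v x ∂μ = ∫ x, u x * v' x ∂μ := by
  simp only [integral_mul_eq_inner] at hsymm ⊢
  exact hu.inner_eq hv rfl fun t => hsymm t u v

theorem HasGenerator.hasEnergy {u u' : Lp ℝ 2 μ} (hu : HasGenerator P u u') (v : Lp ℝ 2 μ) :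
    HasEnergy P u v (-∫ x, u' x * v x ∂μ) := by
  rw [integral_mul_eq_inner]
  have h1 : Tendsto (fun t : ℝ≥0 => -inner ℝ ((t : ℝ)⁻¹ • (P t u - u)) v) (𝓝[>] 0)
      (𝓝 (-inner ℝ u' v)) := (hu.inner tendsto_const_nhds).neg
  refine h1.congr fun t => ?_
  rw [integral_mul_eq_inner, real_inner_smul_left, ← mul_neg, ← inner_neg_left, neg_sub]

/-- Along a suitable subsequence of a given sequence `t_k ↓ 0`, the difference quotients defining
the generator converge almost everywhere. -/
theorem HasGenerator.exists_seq {u u' : Lp ℝ 2 μ} (hu : HasGenerator P u u') {t : ℕ → ℝ≥0}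
    (ht0 : ∀ k, 0 < t k) (ht : Tendsto t atTop (𝓝 0)) :
    ∃ ns : ℕ → ℕ, StrictMono ns ∧ ∀ᵐ x ∂μ,
      Tendsto (fun k => (t (ns k) : ℝ)⁻¹ * (P (t (ns k)) u x - u x)) atTop (𝓝 (u' x)) := by
  have ht' : Tendsto t atTop (𝓝[>] 0) :=
    tendsto_nhdsWithin_iff.2 ⟨ht, Eventually.of_forall fun k => ht0 k⟩
  obtain ⟨ns, hns, hlim⟩ := (tendstoInMeasure_of_tendsto_Lp (hu.comp ht')).exists_seq_tendsto_ae
  refine ⟨ns, hns, ?_⟩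
  have hcoe : ∀ k, ∀ᵐ x ∂μ, ((t k : ℝ)⁻¹ • (P (t k) u - u) : Lp ℝ 2 μ) x =
      (t k : ℝ)⁻¹ * (P (t k) u x - u x) := fun k => by
    filter_upwards [Lp.coeFn_smul (t k : ℝ)⁻¹ (P (t k) u - u), Lp.coeFn_sub (P (t k) u) u]
      with x h1 h2
    rw [h1, Pi.smul_apply, h2, Pi.sub_apply, smul_eq_mul]
  filter_upwards [hlim, ae_all_iff.2 hcoe] with x hx hxc
  exact hx.congr fun k => hxc (ns k)

/-- If the generator is defined at `u`, `v` and `w = uv`, then the carré du champ is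
`(L(uv) - u Lv - v Lu) / 2`. -/
theorem ae_eq_of_generator {u u' v v' w w' : Lp ℝ 2 μ} {G : M → ℝ}
    (hu : HasGenerator P u u') (hv : HasGenerator P v v') (hw : HasGenerator P w w')
    (huv : ∀ᵐ x ∂μ, w x = u x * v x)
    (hG : ∀ t : ℕ → ℝ≥0, (∀ k, 0 < t k) → Tendsto t atTop (𝓝 0) →
      ∀ᵐ x ∂μ, Tendsto (fun k => (2 * (t k : ℝ))⁻¹ * (P (t k) w x - P (t k) u x * P (t k) v x))
        atTop (𝓝 (G x))) :
    ∀ᵐ x ∂μ, G x = (w' x - u x * v' x - v x * u' x) / 2 := by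
  obtain ⟨t₀, -, ht₀0, ht₀⟩ := exists_seq_strictAnti_tendsto (0 : ℝ≥0)
  obtain ⟨a, ha, hua⟩ := hu.exists_seq ht₀0 ht₀
  have hta := ht₀.comp ha.tendsto_atTop
  obtain ⟨b, hb, hvb⟩ := hv.exists_seq (t := t₀ ∘ a) (fun k => ht₀0 _) hta
  have htb := hta.comp hb.tendsto_atTop
  obtain ⟨c, hc, hwc⟩ := hw.exists_seq (t := (t₀ ∘ a) ∘ b) (fun k => ht₀0 _) htb
  have htc := htb.comp hc.tendsto_atTop
  set t : ℕ → ℝ≥0 := ((t₀ ∘ a) ∘ b) ∘ c with htdef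
  have ht0 : ∀ k, 0 < t k := fun k => ht₀0 _
  have htR : Tendsto (fun k => (t k : ℝ)) atTop (𝓝 0) :=
    (NNReal.continuous_coe.tendsto 0).comp htc
  filter_upwards [hua, hvb, hwc, hG t ht0 htc, huv] with x hxu hxv hxw hxG hxuv
  have hxu' : Tendsto (fun k => (t k : ℝ)⁻¹ * (P (t k) u x - u x)) atTop (𝓝 (u' x)) :=
    hxu.comp (hb.tendsto_atTop.comp hc.tendsto_atTop)
  have hxv' : Tendsto (fun k => (t k : ℝ)⁻¹ * (P (t k) v x - v x)) atTop (𝓝 (v' x)) :=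
    hxv.comp hc.tendsto_atTop
  have hxw' : Tendsto (fun k => (t k : ℝ)⁻¹ * (P (t k) w x - w x)) atTop (𝓝 (w' x)) := hxw
  -- `P_t v(x) → v(x)`, because the difference quotients converge
  have hPv : Tendsto (fun k => P (t k) v x) atTop (𝓝 (v x)) := by
    have h := (htR.mul hxv').add_const (v x)
    rw [zero_mul, zero_add] at h
    refine h.congr fun k => ?_
    have : (t k : ℝ) ≠ 0 := (NNReal.coe_pos.2 (ht0 k)).ne'
    field_simp
    ring
  have hlim := ((hxw'.sub (hxv'.const_mul (u x))).sub (hxu'.mul hPv)).div_const 2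
  rw [mul_comm (u' x)] at hlim
  refine tendsto_nhds_unique hxG (hlim.congr fun k => ?_)
  have : (t k : ℝ) ≠ 0 := (NNReal.coe_pos.2 (ht0 k)).ne'
  rw [hxuv]
  field_simp
  ring

end Generator

section GeneratorOnManifold

variable {n : ℕ} {M : Type*} [TopologicalSpace M] [ChartedSpace (EuclideanSpace ℝ (Fin n)) M]

theorem locallyIntegrable_Lp [MeasurableSpace M] {μ : Measure M} [IsLocallyFiniteMeasure μ]
    (v : Lp ℝ 2 μ) : LocallyIntegrable v μ :=
  (Lp.memLp v).locallyIntegrable (by norm_num)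

/-- Strong locality and `χ = 1` near the support of `w` give `⟨Lw, χ⟩ = -𝓔(w, χ) = 0`. -/
theorem integral_generator_mul_eq_zero [MeasurableSpace M] {μ : Measure M}
    {P : ℝ≥0 → Lp ℝ 2 μ →L[ℝ] Lp ℝ 2 μ} (hP : IsDiffusionSemigroup μ P) (hcore : HasSmoothCore n P)
    {w w' : Lp ℝ 2 μ} (hw : HasGenerator P w w') {K V : Set M} (hK : IsClosed K) (hV : IsOpen V)
    (hKV : K ⊆ V) (hwK : ∀ᵐ x ∂μ, x ∉ K → w x = 0) {χ : SmoothFn n M} (hχ : HasCompactSupport χ)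
    (hχV : ∀ x ∈ V, χ x = 1) : ∫ x, w' x * χ x ∂μ = 0 := by
  obtain ⟨z, z', hz, hzL⟩ := hcore χ hχ
  have h1 : HasEnergy P z w 0 := hP.strongly_local z ⟨_, hzL.hasEnergy z⟩ w ⟨_, hw.hasEnergy w⟩ K V
    hK hV hKV hwK ⟨1, by filter_upwards [hz] with x hx hxV; rw [hx, hχV x hxV]⟩
  have h2 := tendsto_nhds_unique h1 (hzL.hasEnergy w)
  rw [integral_mul_congr (u := w') (v := z) EventuallyEq.rfl hz, hw.symm hP.symmetric hzL,
    ← neg_eq_zero, ← h2.symm]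
  congr 1
  exact integral_congr_ae (Eventually.of_forall fun x => mul_comm _ _)

variable [IsManifold (𝓡 n) ∞ M]

theorem IsMetricOf.congr_left {Γ : SmoothFn n M →ₗ[ℝ] SmoothFn n M →ₗ[ℝ] SmoothFn n M}
    {g : SmoothMetric n M} (hg : IsMetricOf Γ g) {f f' h : SmoothFn n M} {x : M}
    (hff' : f =ᶠ[𝓝 x] f') : Γ f h x = Γ f' h x := by
  have hs : ∀ k : SmoothFn n M, Γ k h x = mfderiv (𝓡 n) 𝓘(ℝ, ℝ) k x (grad g h x) := fun k => by
    rw [hg k h x, inner_grad]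
  rw [hs f, hs f']
  have h1 : mfderiv (𝓡 n) 𝓘(ℝ, ℝ) f x = mfderiv (𝓡 n) 𝓘(ℝ, ℝ) f' x := hff'.mfderiv_eq
  exact congrArg (fun L : EuclideanSpace ℝ (Fin n) →L[ℝ] ℝ => L (grad g h x)) h1

variable [T2Space M] [SecondCountableTopology M] [MeasurableSpace M] {μ : Measure M}
  {P : ℝ≥0 → Lp ℝ 2 μ →L[ℝ] Lp ℝ 2 μ}
  {Γ : SmoothFn n M →ₗ[ℝ] SmoothFn n M →ₗ[ℝ] SmoothFn n M} {g : SmoothMetric n M}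

/-- `⟨Lf, φ⟩ = -∫ Γ(f, φ) dμ` for compactly supported smooth functions: integrate
`2 Γ(f, φ) = L(fφ) - f Lφ - φ Lf` against a cutoff `χ`, for which `⟨L(fφ), χ⟩ = 0`. -/
theorem integral_generator_mul_of_compact (hP : IsDiffusionSemigroup μ P)
    (hcore : HasSmoothCore n P) (hΓ : IsSmoothCarreDuChamp P Γ) (hg : IsMetricOf Γ g)
    {f φ : SmoothFn n M} (hf : HasCompactSupport f) (hφ : HasCompactSupport φ)
    {u u' : Lp ℝ 2 μ} (hu : u =ᵐ[μ] f) (huL : HasGenerator P u u') :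
    ∫ x, u' x * φ x ∂μ = -∫ x, Γ f φ x ∂μ := by
  obtain ⟨v, v', hv, hvL⟩ := hcore φ hφ
  have hfφ : HasCompactSupport (f * φ : SmoothFn n M) := hf.mul_right
  obtain ⟨w, w', hw, hwL⟩ := hcore (f * φ) hfφ
  have hwuv : ∀ᵐ x ∂μ, w x = u x * v x := by
    filter_upwards [hu, hv, hw] with x h1 h2 h3
    rw [h1, h2, h3]
    rfl
  have hae := ae_eq_of_generator huL hvL hwL hwuv (hΓ.limit f φ hf hφ u v w hu hv hw)
  -- test against a function equal to `1` near both supports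
  obtain ⟨χ, V, hχ, -, hV, hKV, hχV⟩ := exists_smoothFn_eq_one (n := n)
    (hf.isCompact.union hφ.isCompact) isOpen_univ (subset_univ _)
  have hχf : ∀ x, f x * χ x = f x := fun x => by
    by_cases hx : x ∈ tsupport f
    · rw [hχV x (hKV (Or.inl hx)), mul_one]
    · rw [image_eq_zero_of_notMem_tsupport hx, zero_mul]
  have hχφ : ∀ x, φ x * χ x = φ x := fun x => by
    by_cases hx : x ∈ tsupport φ
    · rw [hχV x (hKV (Or.inr hx)), mul_one]
    · rw [image_eq_zero_of_notMem_tsupport hx, zero_mul]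
  have hχΓ : ∀ x, Γ f φ x * χ x = Γ f φ x := fun x => by
    by_cases hx : x ∈ tsupport φ
    · rw [hχV x (hKV (Or.inr hx)), mul_one]
    · rw [hg.eq_zero_of_notMem_tsupport f hx, zero_mul]
  have h0 := integral_generator_mul_eq_zero hP hcore hwL
    ((isClosed_tsupport f).union (isClosed_tsupport φ)) hV hKV (by
      filter_upwards [hw] with x hx hxK
      rw [hx, SmoothFn.mul_apply, image_eq_zero_of_notMem_tsupport fun h => hxK (Or.inl h),
        zero_mul]) hχ hχV
  obtain ⟨z, -, hz, -⟩ := hcore χ hχ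
  have i1 : Integrable (fun x => w' x * χ x) μ := integrable_mul_congr EventuallyEq.rfl hz
  have i2 : Integrable (fun x => f x * v' x) μ := integrable_mul_congr hu EventuallyEq.rfl
  have i3 : Integrable (fun x => u' x * φ x) μ := integrable_mul_congr EventuallyEq.rfl hv
  have h1 : ∫ x, Γ f φ x ∂μ = ∫ x, (w' x * χ x - f x * v' x - u' x * φ x) / 2 ∂μ := by
    refine integral_congr_ae ?_
    filter_upwards [hae, hu, hv] with x hx hxu hxv
    rw [← hχΓ x, hx, hxu, hxv]
    linear_combination (- v' x / 2) * hχf x - (u' x / 2) * hχφ x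
  have h2 : ∫ x, f x * v' x ∂μ = ∫ x, u' x * φ x ∂μ := by
    rw [integral_mul_congr hu EventuallyEq.rfl, ← huL.symm hP.symmetric hvL,
      integral_mul_congr EventuallyEq.rfl hv]
  have h3 := integral_sub (i1.sub i2) i3
  simp only [Pi.sub_apply] at h3
  rw [h1, integral_div, h3, integral_sub i1 i2, h0, h2]
  ring

variable [BorelSpace M]

/-- The fundamental lemma of the calculus of variations for smooth test functions. -/
theorem ae_eq_zero_of_integral_smoothFn {U : Set M} (hU : IsOpen U) {v : M → ℝ}
    (hv : LocallyIntegrableOn v U μ)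
    (h : ∀ φ : SmoothFn n M, HasCompactSupport φ → tsupport φ ⊆ U → ∫ x, v x * φ x ∂μ = 0) :
    ∀ᵐ x ∂μ, x ∈ U → v x = 0 := by
  have : LocallyCompactSpace M := ChartedSpace.locallyCompactSpace (EuclideanSpace ℝ (Fin n)) M
  refine hU.ae_eq_zero_of_integral_contMDiff_smul_eq_zero (𝓡 n) hv fun φ hφ hφc hφU => ?_
  rw [← h ⟨φ, hφ⟩ hφc hφU]
  exact integral_congr_ae (Eventually.of_forall fun x => mul_comm _ _)

variable [IsLocallyFiniteMeasure μ]

theorem generator_eq_zero_of_notMem_tsupport (hP : IsDiffusionSemigroup μ P)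
    (hcore : HasSmoothCore n P) (hΓ : IsSmoothCarreDuChamp P Γ) (hg : IsMetricOf Γ g)
    {f : SmoothFn n M} (hf : HasCompactSupport f)
    {u u' : Lp ℝ 2 μ} (hu : u =ᵐ[μ] f) (huL : HasGenerator P u u') :
    ∀ᵐ x ∂μ, x ∉ tsupport f → u' x = 0 := by
  refine ae_eq_zero_of_integral_smoothFn (n := n) (isClosed_tsupport f).isOpen_compl
    ((locallyIntegrable_Lp u').locallyIntegrableOn _) fun φ hφ hφU => ?_
  rw [integral_generator_mul_of_compact hP hcore hΓ hg hf hφ hu huL, neg_eq_zero]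
  refine integral_eq_zero_of_ae (Eventually.of_forall fun x => ?_)
  by_cases hx : x ∈ tsupport φ
  · rw [hΓ.symm, hg.eq_zero_of_notMem_tsupport φ (hφU hx)]
    rfl
  · rw [hg.eq_zero_of_notMem_tsupport f hx]
    rfl

/-- `⟨Lf, φ⟩ = -∫ Γ(f, φ) dμ` for smooth `f` in the domain of the generator and compactly supported
smooth `φ`. As `Lφ` vanishes off `supp φ`, symmetry of `L` allows `f` to be cut off outside a
neighbourhood of `supp φ`. -/
theorem integral_generator_mul (hP : IsDiffusionSemigroup μ P)
    (hcore : HasSmoothCore n P) (hΓ : IsSmoothCarreDuChamp P Γ) (hg : IsMetricOf Γ g)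
    {f φ : SmoothFn n M} (hφ : HasCompactSupport φ)
    {u u' : Lp ℝ 2 μ} (hu : u =ᵐ[μ] f) (huL : HasGenerator P u u') :
    ∫ x, u' x * φ x ∂μ = -∫ x, Γ f φ x ∂μ := by
  obtain ⟨v, v', hv, hvL⟩ := hcore φ hφ
  obtain ⟨χ, V, hχ, -, hV, hKV, hχV⟩ := exists_smoothFn_eq_one (n := n)
    hφ.isCompact isOpen_univ (subset_univ _)
  have hfχ : HasCompactSupport (f * χ : SmoothFn n M) := hχ.mul_left
  obtain ⟨w, w', hw, hwL⟩ := hcore (f * χ) hfχ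
  have hv0 := generator_eq_zero_of_notMem_tsupport hP hcore hΓ hg hφ hv hvL
  have h1 : ∫ x, f x * v' x ∂μ = ∫ x, (f * χ : SmoothFn n M) x * v' x ∂μ := by
    refine integral_congr_ae ?_
    filter_upwards [hv0] with x hx
    by_cases hxφ : x ∈ tsupport φ
    · rw [SmoothFn.mul_apply, hχV x (hKV hxφ), mul_one]
    · rw [hx hxφ, mul_zero, mul_zero]
  have h2 : ∫ x, Γ (f * χ) φ x ∂μ = ∫ x, Γ f φ x ∂μ := by
    refine integral_congr_ae (Eventually.of_forall fun x => ?_)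
    by_cases hxφ : x ∈ tsupport φ
    · refine hg.congr_left ?_
      filter_upwards [hV.mem_nhds (hKV hxφ)] with z hz
      rw [SmoothFn.mul_apply, hχV z hz, mul_one]
    · simp only [hg.eq_zero_of_notMem_tsupport _ hxφ]
  rw [← h2, ← integral_generator_mul_of_compact hP hcore hΓ hg hfχ hφ hw hwL,
    integral_mul_congr EventuallyEq.rfl hv, huL.symm hP.symmetric hvL,
    ← integral_mul_congr hu EventuallyEq.rfl, h1, integral_mul_congr hw EventuallyEq.rfl,
    ← hwL.symm hP.symmetric hvL, integral_mul_congr EventuallyEq.rfl hv]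

/-- The generator is the weighted Laplacian on smooth functions of its domain. -/
theorem generator_ae_eq_weightedLaplacian (hP : IsDiffusionSemigroup μ P)
    (hcore : HasSmoothCore n P) (hΓ : IsSmoothCarreDuChamp P Γ) (hg : IsMetricOf Γ g)
    [Nonempty M] [μ.IsOpenPosMeasure] {ρ : M → ℝ} (h : IsChartDensity g μ ρ)
    (hρ : ContMDiff (𝓡 n) 𝓘(ℝ, ℝ) ∞ ρ) (hpos : ∀ x, 0 < ρ x) {f : SmoothFn n M}
    {u u' : Lp ℝ 2 μ} (hu : u =ᵐ[μ] f) (huL : HasGenerator P u u') :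
    u' =ᵐ[μ] weightedLaplacian g ρ f := by
  have hcont := h.continuous_weightedLaplacian hg hρ hpos f
  have hloc : ∀ c : M, ∀ᵐ x ∂μ, x ∈ (chart[n] c).source → u' x - weightedLaplacian g ρ f x = 0 := by
    intro c
    refine ae_eq_zero_of_integral_smoothFn (n := n) (chart[n] c).open_source
      (((locallyIntegrable_Lp u').sub hcont.locallyIntegrable).locallyIntegrableOn _)
      fun φ hφ hφc => ?_
    obtain ⟨v, -, hv, -⟩ := hcore φ hφ
    have i1 : Integrable (fun x => u' x * φ x) μ := integrable_mul_congr EventuallyEq.rfl hv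
    have i2 : Integrable (fun x => weightedLaplacian g ρ f x * φ x) μ :=
      (hcont.mul φ.contMDiff.continuous).integrable_of_hasCompactSupport hφ.mul_left
    have h1 : ∫ x, weightedLaplacian g ρ f x * φ x ∂μ = -∫ x, Γ f φ x ∂μ := by
      rw [← h.integral_chartLaplacian hg hρ hpos f hφ hφc]
      refine integral_congr_ae (Eventually.of_forall fun x => ?_)
      by_cases hx : x ∈ tsupport φ
      · simp only [h.weightedLaplacian_eq_chart hg hρ hpos f (hφc hx)]
      · simp only [image_eq_zero_of_notMem_tsupport hx, mul_zero]
    simp only [sub_mul]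
    rw [integral_sub i1 i2, integral_generator_mul hP hcore hΓ hg hφ hu huL, h1, sub_self]
  obtain ⟨c, hc⟩ := exists_chart_cover n M
  filter_upwards [ae_all_iff.2 fun k => hloc (c k)] with x hx
  obtain ⟨k, hk⟩ := mem_iUnion.1 (hc.symm ▸ mem_univ x)
  exact sub_eq_zero.1 (hx k hk)

end GeneratorOnManifold

/-! ### Uniqueness of densities and of symmetrizing measures -/

section DensityUnique

theorem withDensity_ofReal_div {M : Type*} [MeasurableSpace M] (m : Measure M) {ρ σ : M → ℝ}
    (hρ : Measurable ρ) (hσ : Measurable σ) (hpos : ∀ x, 0 < ρ x) :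
    m.withDensity (fun x => ENNReal.ofReal (σ x)) =
      (m.withDensity fun x => ENNReal.ofReal (ρ x)).withDensity
        fun x => ENNReal.ofReal (σ x / ρ x) := by
  have h : Measurable fun x => σ x / ρ x := hσ.div hρ
  rw [← withDensity_mul _ hρ.ennreal_ofReal h.ennreal_ofReal]
  congr 1
  funext x
  rw [Pi.mul_apply, ← ENNReal.ofReal_mul (hpos x).le, mul_div_cancel₀ _ (hpos x).ne']

/-- A continuous positive density with respect to a given measure `m` is determined by the measure
it defines, if the latter is `σ`-finite and charges every nonempty open set. -/
theorem eq_of_withDensity_ofReal_eq {M : Type*} [TopologicalSpace M] [MeasurableSpace M]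
    [BorelSpace M] {m μ : Measure M} [SigmaFinite μ] [μ.IsOpenPosMeasure] {ρ σ : M → ℝ}
    (hρ : Continuous ρ) (hσ : Continuous σ) (hρ0 : ∀ x, 0 < ρ x)
    (hμρ : μ = m.withDensity fun x => ENNReal.ofReal (ρ x))
    (hμσ : μ = m.withDensity fun x => ENNReal.ofReal (σ x)) : σ = ρ := by
  have h1 : μ.withDensity (fun x => ENNReal.ofReal (σ x / ρ x)) = μ.withDensity 1 := by
    rw [withDensity_one]
    conv_rhs => rw [hμσ, withDensity_ofReal_div m hρ.measurable hσ.measurable hρ0, ← hμρ]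
  have hm : Measurable fun x => σ x / ρ x := hσ.measurable.div hρ.measurable
  have h2 : (fun x => ENNReal.ofReal (σ x / ρ x)) =ᵐ[μ] 1 := (withDensity_eq_iff_of_sigmaFinite
    hm.ennreal_ofReal.aemeasurable aemeasurable_one).1 h1
  have h3 : σ =ᵐ[μ] ρ := by
    filter_upwards [h2] with x hx
    have h4 : σ x / ρ x = 1 := by
      rwa [Pi.one_apply, ENNReal.ofReal_eq_one] at hx
    exact (div_eq_one_iff_eq (hρ0 x).ne').1 h4
  exact (Continuous.ae_eq_iff_eq μ hσ hρ).1 h3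

end DensityUnique

section Uniqueness

variable {n : ℕ} {M : Type*} [TopologicalSpace M] [ChartedSpace (EuclideanSpace ℝ (Fin n)) M]
  [IsManifold (𝓡 n) ∞ M]
  {Γ : SmoothFn n M →ₗ[ℝ] SmoothFn n M →ₗ[ℝ] SmoothFn n M} {g : SmoothMetric n M}

theorem SmoothFn.eq_const_of_mfderiv_eq_zero [ConnectedSpace M] (θ : SmoothFn n M)
    (h : ∀ x, mfderiv (𝓡 n) 𝓘(ℝ, ℝ) θ x = 0) (x y : M) : θ x = θ y := by
  have hloc : IsLocallyConstant θ := by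
    rw [IsLocallyConstant.iff_eventually_eq]
    intro c
    have hc := mem_chart_source (EuclideanSpace ℝ (Fin n)) c
    obtain ⟨r, hr, hball⟩ := Metric.isOpen_iff.1 (chart[n] c).open_target _
      ((chart[n] c).map_source hc)
    have hsm := contDiffOn_comp_chart_symm (c := c) θ.contMDiff.contMDiffOn
    filter_upwards [(chart[n] c).open_source.mem_nhds hc,
      ((chart[n] c).continuousAt hc).preimage_mem_nhds (Metric.ball_mem_nhds _ hr)] with z hz hzr
    have h1 := Metric.isOpen_ball.is_const_of_fderiv_eq_zero
      (convex_ball (chart[n] c c) r).isPreconnected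
      ((hsm.mono hball).differentiableOn (by simp)) (fun y hy => by
        have hy' := hball hy
        ext i
        rw [fderiv_apply_eq_sum_partialD]
        refine Finset.sum_eq_zero fun i _ => ?_
        rw [← mfderiv_coordVec hy' (θ.mdifferentiableAt _), h]
        exact zero_mul (M₀ := ℝ) _) hzr (Metric.mem_ball_self hr)
    simpa only [Function.comp_apply, (chart[n] c).left_inv hz, (chart[n] c).left_inv hc] using h1
  exact hloc.apply_eq_of_preconnectedSpace x y

variable [T2Space M]

/-- Testing `Γ(f, θ) = 0` with `f = θ` near `x` gives `Γ(θ, θ)(x) = 0`, so `dθ(x) = 0`. -/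
theorem IsCometric.eq_const_of_forall_eq_zero [ConnectedSpace M] (hΓ : IsCometric Γ)
    (hg : IsMetricOf Γ g) (θ : SmoothFn n M)
    (h : ∀ f : SmoothFn n M, HasCompactSupport f → ∀ x, Γ f θ x = 0) (x y : M) : θ x = θ y := by
  refine θ.eq_const_of_mfderiv_eq_zero (fun z => ?_) x y
  by_contra hne
  obtain ⟨f, hf, -, hfz⟩ := exists_smoothFn_eventuallyEq (n := n) isOpen_univ (mem_univ z)
    θ.contMDiff.contMDiffOn
  exact (hΓ.pos θ z hne).ne' ((hg.congr_left hfz).symm.trans (h f hf z))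

variable [MeasurableSpace M] {μ : Measure M} {P : ℝ≥0 → Lp ℝ 2 μ →L[ℝ] Lp ℝ 2 μ}

/-- Weighted Laplacians which both restrict to the generator on `C_c^∞` have proportional weights:
their difference is the derivation `Γ(log σ - log ρ, ·)`. -/
theorem eq_mul_of_generator_eq [ConnectedSpace M] [μ.IsOpenPosMeasure]
    (hcore : HasSmoothCore n P) (hΓ : IsCometric Γ)
    (hg : IsMetricOf Γ g) {ρ σ : M → ℝ} (hρ : ContMDiff (𝓡 n) 𝓘(ℝ, ℝ) ∞ ρ)
    (hσ : ContMDiff (𝓡 n) 𝓘(ℝ, ℝ) ∞ σ) (hρ0 : ∀ x, 0 < ρ x) (hσ0 : ∀ x, 0 < σ x)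
    (hLρ : ∀ (f : SmoothFn n M) (u v : Lp ℝ 2 μ), HasCompactSupport f → u =ᵐ[μ] f →
      HasGenerator P u v → v =ᵐ[μ] weightedLaplacian g ρ f)
    (hLσ : ∀ (f : SmoothFn n M) (u v : Lp ℝ 2 μ), HasCompactSupport f → u =ᵐ[μ] f →
      HasGenerator P u v → v =ᵐ[μ] weightedLaplacian g σ f) :
    ∃ c : ℝ, 0 < c ∧ ∀ x, σ x = c * ρ x := by
  have hlog : ∀ {τ : M → ℝ}, ContMDiff (𝓡 n) 𝓘(ℝ, ℝ) ∞ τ → (∀ x, 0 < τ x) →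
      ContMDiff (𝓡 n) 𝓘(ℝ, ℝ) ∞ fun x => Real.log (τ x) := fun {τ} hτ hτ0 x =>
    (Real.contDiffAt_log.2 (hτ0 x).ne').contMDiffAt.comp x (hτ x)
  let lρ : SmoothFn n M := ⟨_, hlog hρ hρ0⟩
  let lσ : SmoothFn n M := ⟨_, hlog hσ hσ0⟩
  have key : ∀ f : SmoothFn n M, HasCompactSupport f → ∀ x, Γ f (lσ - lρ) x = 0 := by
    intro f hf
    obtain ⟨u, v, hu, huv⟩ := hcore f hf
    have hae : (Γ f lσ : M → ℝ) =ᵐ[μ] Γ f lρ := by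
      filter_upwards [hLρ f u v hf hu huv, hLσ f u v hf hu huv] with x h1 h2
      have h3 := add_left_cancel (h1.symm.trans h2)
      rw [inner_grad, inner_grad] at h3
      rw [hg.eq_mfderiv_grad, hg.eq_mfderiv_grad]
      exact h3.symm
    have heq := (Continuous.ae_eq_iff_eq μ (Γ f lσ).contMDiff.continuous
      (Γ f lρ).contMDiff.continuous).1 hae
    intro x
    rw [map_sub]
    exact sub_eq_zero.2 (congrFun heq x)
  obtain ⟨p⟩ : Nonempty M := inferInstance
  refine ⟨Real.exp ((lσ - lρ) p), Real.exp_pos _, fun x => ?_⟩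
  have h1 : Real.log (σ x) - Real.log (ρ x) = (lσ - lρ) p :=
    hΓ.eq_const_of_forall_eq_zero hg (lσ - lρ) key x p
  rw [← h1, Real.exp_sub, Real.exp_log (hσ0 x), Real.exp_log (hρ0 x),
    div_mul_cancel₀ _ (hρ0 x).ne']

variable [SecondCountableTopology M] [BorelSpace M] [IsLocallyFiniteMeasure μ]

/-- If `∫ h Γ(f, θ) dμ` is symmetric in `f, h`, then it vanishes: with `f = 1` near `supp h` it
follows that `∫ Γ(h, θ) dμ = 0`, and for a product `h = ab` the Leibniz rule turns this into
`2 ∫ a Γ(b, θ) dμ = 0`. -/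
theorem carreDuChamp_eq_zero_of_symm [μ.IsOpenPosMeasure]
    (hΓ : IsSmoothCarreDuChamp P Γ) (hg : IsMetricOf Γ g)
    (θ : SmoothFn n M)
    (hsymm : ∀ f h : SmoothFn n M, HasCompactSupport f → HasCompactSupport h →
      ∫ x, h x * Γ f θ x ∂μ = ∫ x, f x * Γ h θ x ∂μ)
    (f : SmoothFn n M) (hf : HasCompactSupport f) (x : M) : Γ f θ x = 0 := by
  have hsupp : ∀ (h : SmoothFn n M) {x : M}, x ∉ tsupport h → Γ h θ x = 0 := fun h x hx => by
    rw [hΓ.symm]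
    exact hg.eq_zero_of_notMem_tsupport θ hx
  have hint : ∀ f h : SmoothFn n M, HasCompactSupport h →
      Integrable (fun x => h x * Γ f θ x) μ := fun f h hh =>
    (h.contMDiff.continuous.mul (Γ f θ).contMDiff.continuous).integrable_of_hasCompactSupport
      hh.mul_right
  have h0 : ∀ h : SmoothFn n M, HasCompactSupport h → ∫ x, Γ h θ x ∂μ = 0 := by
    intro h hh
    obtain ⟨χ, V, hχ, -, hV, hKV, hχV⟩ := exists_smoothFn_eq_one (n := n)
      hh.isCompact isOpen_univ (subset_univ _)
    have h1 := hsymm χ h hχ hh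
    have h2 : ∀ x, h x * Γ χ θ x = 0 := fun x => by
      by_cases hx : x ∈ tsupport h
      · have hχ1 : χ =ᶠ[𝓝 x] fun _ => (1 : ℝ) := by
          filter_upwards [hV.mem_nhds (hKV hx)] with z hz using hχV z hz
        rw [hΓ.symm, hg.eq_mfderiv_grad, hχ1.mfderiv_eq, mfderiv_const]
        exact mul_zero (M₀ := ℝ) _
      · rw [image_eq_zero_of_notMem_tsupport hx, zero_mul]
    have h3 : ∀ x, χ x * Γ h θ x = Γ h θ x := fun x => by
      by_cases hx : x ∈ tsupport h
      · rw [hχV x (hKV hx), one_mul]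
      · rw [hsupp h hx, mul_zero]
    simp only [h2, h3, integral_zero] at h1
    exact h1.symm
  have h1 : ∀ φ : SmoothFn n M, HasCompactSupport φ → ∫ x, Γ f θ x * φ x ∂μ = 0 := by
    intro φ hφ
    have h2 := h0 (f * φ) hf.mul_right
    have h3 : ∀ x, Γ (f * φ) θ x = f x * Γ φ θ x + φ x * Γ f θ x := fun x => by
      rw [hΓ.leibniz_left]
      rfl
    simp only [h3] at h2
    rw [integral_add (hint φ f hf) (hint f φ hφ), ← hsymm f φ hf hφ] at h2
    simp only [mul_comm _ (φ _)]
    linarith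
  have hcont := (Γ f θ).contMDiff.continuous
  have h2 : (Γ f θ : M → ℝ) =ᵐ[μ] fun _ => 0 := by
    filter_upwards [ae_eq_zero_of_integral_smoothFn (n := n) isOpen_univ
      ((hcont.locallyIntegrable (μ := μ)).locallyIntegrableOn univ) fun φ hφ _ => h1 φ hφ]
      with x hx using hx (mem_univ x)
  exact congrFun ((Continuous.ae_eq_iff_eq μ hcont continuous_const).1 h2) x

/-- Differentiating the symmetry of `P_t` with respect to `θ μ` at `t = 0`. -/
theorem integral_mul_carreDuChamp_symm (hP : IsDiffusionSemigroup μ P) (hcore : HasSmoothCore n P)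
    (hΓ : IsSmoothCarreDuChamp P Γ) (hg : IsMetricOf Γ g) {θ : SmoothFn n M}
    (hθ : ∀ (t : ℝ≥0) (f h : SmoothFn n M) (u v : Lp ℝ 2 μ),
      HasCompactSupport f → HasCompactSupport h → u =ᵐ[μ] f → v =ᵐ[μ] h →
      ∫ x, θ x * (P t u x * h x) ∂μ = ∫ x, θ x * (f x * P t v x) ∂μ)
    {f h : SmoothFn n M} (hf : HasCompactSupport f) (hh : HasCompactSupport h) :
    ∫ x, h x * Γ f θ x ∂μ = ∫ x, f x * Γ h θ x ∂μ := by
  have hfθ : HasCompactSupport (f * θ : SmoothFn n M) := hf.mul_right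
  have hhθ : HasCompactSupport (h * θ : SmoothFn n M) := hh.mul_right
  obtain ⟨u, u', hu, huL⟩ := hcore f hf
  obtain ⟨v, v', hv, hvL⟩ := hcore h hh
  obtain ⟨z, -, hz, -⟩ := hcore (h * θ) hhθ
  obtain ⟨w, -, hw, -⟩ := hcore (f * θ) hfθ
  have h1 : ∀ t, inner ℝ (P t u) z = inner ℝ w (P t v) := fun t => by
    rw [← integral_mul_eq_inner, ← integral_mul_eq_inner]
    refine Eq.trans ?_ ((hθ t f h u v hf hh hu hv).trans ?_) <;> refine integral_congr_ae ?_
    · filter_upwards [hz] with x hx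
      rw [hx, SmoothFn.mul_apply]
      ring
    · filter_upwards [hw] with x hx
      rw [hx, SmoothFn.mul_apply]
      ring
  have h0 := h1 0
  rw [hP.zero, ContinuousLinearMap.id_apply, ContinuousLinearMap.id_apply] at h0
  have h2 := huL.inner_eq hvL h0 h1
  have h3 : ∫ x, u' x * (h * θ : SmoothFn n M) x ∂μ = ∫ x, v' x * (f * θ : SmoothFn n M) x ∂μ := by
    rw [integral_mul_congr EventuallyEq.rfl hz, integral_mul_congr EventuallyEq.rfl hw,
      integral_mul_eq_inner, integral_mul_eq_inner, h2, real_inner_comm]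
  rw [integral_generator_mul hP hcore hΓ hg hhθ hu huL,
    integral_generator_mul hP hcore hΓ hg hfθ hv hvL, neg_inj] at h3
  have hexp : ∀ a b : SmoothFn n M, ∀ x, Γ a (b * θ) x = b x * Γ a θ x + θ x * Γ a b x :=
    fun a b x => by
      rw [hΓ.leibniz_right]
      rfl
  simp only [hexp] at h3
  have i1 : ∀ a b : SmoothFn n M, HasCompactSupport b → Integrable (fun x => b x * Γ a θ x) μ :=
    fun a b hb => (b.contMDiff.continuous.mul
      (Γ a θ).contMDiff.continuous).integrable_of_hasCompactSupport hb.mul_right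
  have i2 : ∀ a b : SmoothFn n M, HasCompactSupport b → Integrable (fun x => θ x * Γ a b x) μ :=
    fun a b hb => (θ.contMDiff.continuous.mul
      (Γ a b).contMDiff.continuous).integrable_of_hasCompactSupport
        (hg.hasCompactSupport a hb).mul_left
  rw [integral_add (i1 f h hh) (i2 f h hh), integral_add (i1 h f hf) (i2 h f hf), hΓ.symm h f] at h3
  exact add_right_cancel h3

/-- The smooth positive measures which symmetrize the semigroup are the multiples of `μ`. -/
theorem eq_smul_of_symmetrizing [ConnectedSpace M] [μ.IsOpenPosMeasure]
    (hP : IsDiffusionSemigroup μ P) (hcore : HasSmoothCore n P) (hΓ : IsSmoothCarreDuChamp P Γ)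
    (hcom : IsCometric Γ) (hg : IsMetricOf Γ g) {ρ : M → ℝ}
    (hρ : ContMDiff (𝓡 n) 𝓘(ℝ, ℝ) ∞ ρ) (hρ0 : ∀ x, 0 < ρ x)
    (hμ : μ = (riemannianVolume g).withDensity fun x => ENNReal.ofReal (ρ x))
    {ν : Measure M} (hν : IsSmoothPositiveMeasure n ν)
    (hνP : ∀ (t : ℝ≥0) (f h : SmoothFn n M) (u v : Lp ℝ 2 μ),
      HasCompactSupport f → HasCompactSupport h → u =ᵐ[μ] f → v =ᵐ[μ] h →
      ∫ x, P t u x * h x ∂ν = ∫ x, f x * P t v x ∂ν) :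
    ∃ c : ℝ≥0, 0 < c ∧ ν = c • μ := by
  obtain ⟨σ, hσ, hσ0, hσν⟩ := hg.exists_chartDensity hν
  let θ : SmoothFn n M := ⟨fun x => σ x / ρ x, hσ.div₀ hρ fun x => (hρ0 x).ne'⟩
  have hθ0 : ∀ x, 0 < θ x := fun x => div_pos (hσ0 x) (hρ0 x)
  have hνμ : ν = μ.withDensity fun x => ENNReal.ofReal (θ x) := by
    rw [hσν.eq_withDensity hg hσ hσ0]
    conv_rhs => rw [hμ]
    exact withDensity_ofReal_div _ hρ.continuous.measurable hσ.continuous.measurable hρ0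
  have hint : ∀ F : M → ℝ, ∫ x, F x ∂ν = ∫ x, θ x * F x ∂μ := fun F => by
    rw [hνμ, integral_withDensity_eq_integral_toReal_smul
      θ.contMDiff.continuous.measurable.ennreal_ofReal
      (Eventually.of_forall fun x => ENNReal.ofReal_lt_top)]
    exact integral_congr_ae (Eventually.of_forall fun x => by
      simp only [ENNReal.toReal_ofReal (hθ0 x).le, smul_eq_mul])
  simp only [hint] at hνP
  have hconst := hcom.eq_const_of_forall_eq_zero hg θ
    (carreDuChamp_eq_zero_of_symm hΓ hg θ fun f h hf hh =>
      integral_mul_carreDuChamp_symm hP hcore hΓ hg hνP hf hh)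
  obtain ⟨p⟩ : Nonempty M := inferInstance
  refine ⟨(θ p).toNNReal, Real.toNNReal_pos.2 (hθ0 p), ?_⟩
  rw [hνμ]
  simp only [fun x => hconst x p]
  rw [withDensity_const]
  rfl

end Uniqueness

end

theorem theorem4p7 {n : ℕ} {M : Type*} [TopologicalSpace M]
    [ChartedSpace (EuclideanSpace ℝ (Fin n)) M] [IsManifold (𝓡 n) ∞ M] [T2Space M]
    [SecondCountableTopology M] [ConnectedSpace M] [MeasurableSpace M] [BorelSpace M]
    (μ : Measure M) [SigmaFinite μ] [μ.IsOpenPosMeasure]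
    (P : ℝ≥0 → Lp ℝ 2 μ →L[ℝ] Lp ℝ 2 μ)
    (Γ : SmoothFn n M →ₗ[ℝ] SmoothFn n M →ₗ[ℝ] SmoothFn n M)
    (hP : IsDiffusionSemigroup μ P)
    (hμ : IsSmoothPositiveMeasure n μ)
    (hcore : HasSmoothCore n P)
    (hΓ : IsSmoothCarreDuChamp P Γ)
    (hpos : IsNondegenerate Γ) :
    -- the recovered metric
    ∃ g : SmoothMetric n M, IsMetricOf Γ g ∧ (∀ g' : SmoothMetric n M, IsMetricOf Γ g' → g' = g) ∧
    -- the density of the reference measure exists and is unique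
    ∃ ρ : M → ℝ,
      (ContMDiff (𝓡 n) 𝓘(ℝ, ℝ) ∞ ρ ∧ (∀ x, 0 < ρ x) ∧
        μ = (riemannianVolume g).withDensity (fun x => ENNReal.ofReal (ρ x))) ∧
      (∀ σ : M → ℝ, ContMDiff (𝓡 n) 𝓘(ℝ, ℝ) ∞ σ → (∀ x, 0 < σ x) →
        μ = (riemannianVolume g).withDensity (fun x => ENNReal.ofReal (σ x)) → σ = ρ) ∧
    -- the generator is the weighted Laplacian on the smooth functions of its domain
      (∀ (f : SmoothFn n M) (u v : Lp ℝ 2 μ), u =ᵐ[μ] f → HasGenerator P u v →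
        v =ᵐ[μ] weightedLaplacian g ρ f) ∧
    -- the generator determines the density up to a constant
      (∀ σ : M → ℝ, ContMDiff (𝓡 n) 𝓘(ℝ, ℝ) ∞ σ → (∀ x, 0 < σ x) →
        (∀ (f : SmoothFn n M) (u v : Lp ℝ 2 μ), HasCompactSupport f → u =ᵐ[μ] f →
          HasGenerator P u v → v =ᵐ[μ] weightedLaplacian g σ f) →
        ∃ c : ℝ, 0 < c ∧ ∀ x, σ x = c * ρ x) ∧
    -- the semigroup determines its symmetrizing smooth positive measure up to a constant
      (∀ ν : Measure M, IsSmoothPositiveMeasure n ν →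
        (∀ (t : ℝ≥0) (f h : SmoothFn n M) (u v : Lp ℝ 2 μ),
          HasCompactSupport f → HasCompactSupport h → u =ᵐ[μ] f → v =ᵐ[μ] h →
          ∫ x, P t u x * h x ∂ν = ∫ x, f x * P t v x ∂ν) →
        ∃ c : ℝ≥0, 0 < c ∧ ν = c • μ) := by
  have hcom : IsCometric Γ := ⟨hΓ.symm, hΓ.first_order, hpos⟩
  obtain ⟨g, hg⟩ := hcom.exists_isMetricOf
  obtain ⟨ρ, hρ, hρ0, hd⟩ := hg.exists_chartDensity hμ
  have := hd.isLocallyFiniteMeasure hg hρ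
  have hμρ := hd.eq_withDensity hg hρ hρ0
  have hL : ∀ (f : SmoothFn n M) (u v : Lp ℝ 2 μ), u =ᵐ[μ] f → HasGenerator P u v →
      v =ᵐ[μ] weightedLaplacian g ρ f := fun f u v hu huv =>
    generator_ae_eq_weightedLaplacian hP hcore hΓ hg hd hρ hρ0 hu huv
  exact ⟨g, hg, fun g' hg' => hcom.metric_unique hg hg', ρ, ⟨hρ, hρ0, hμρ⟩,
    fun σ hσ hσ0 hμσ => eq_of_withDensity_ofReal_eq hρ.continuous hσ.continuous hρ0 hμρ hμσ,
    hL, fun σ hσ hσ0 hLσ => eq_mul_of_generator_eq hcore hcom hg hρ hσ hρ0 hσ0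
      (fun f u v _ hu huv => hL f u v hu huv) hLσ,
    fun ν hν hνP => eq_smul_of_symmetrizing hP hcore hΓ hcom hg hρ hρ0 hμρ hν hνP⟩
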